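/- Let $n\ge 2$ and let $p:\mathbb R^n\to\mathbb R$ be a bounded log-Hölder continuous variable exponent, i.e. there are constants $p^-,p^+$ with $1<p^-\le p(x)\le p^+<\infty$ for all $x$, and a constant $L>0$ with $\left|\frac1{p(x)}-\frac1{p(y)}\right|\le \frac{L}{\log(e+1/|x-y|)}$ for all $x\neq y$. Let $\Omega\subset\mathbb R^n$ be open, $w\in\partial\Omega$ and $0<r<\infty$. For an open set $D$, $W^{1,p(\cdot)}_{loc}(D)$ is the set of functions $v$ on $D$ with a distributional gradient $\nabla v$ in $D$ such that $v$ and $\nabla v$ belong to $L^{p(\cdot)}(K)$ for every compact $K\subset D$, where $f\in L^{p(\cdot)}(K)$ means that $f$ is measurable and $\int_K |f(x)/c|^{p(x)}\,dx<\infty$ for some $c>0$. A function $v$ is $p(\cdot)$-harmonic in $D$ if it is continuous, belongs to $W^{1,p(\cdot)}_{loc}(D)$, and $\int_D\langle|\nabla v|^{p(x)-2}\nabla v,\nabla\phi\rangle\,dx=0$ for all $\phi\in C_0^\infty(D)$; the vector $|\nabla v|^{p(x)-2}\nabla v$ is read as $0$ where $\nabla v=0$. Suppose that $u$ is a positive $p(\cdot)$-harmonic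 function in $\Omega\cap B(w,2r)$, continuous on $\overline\Omega\cap B(w,2r)$, with $u=0$ on $\partial\Omega\cap B(w,2r)$. Extend $u$ to $B(w,2r)$ by $u=0$ on $B(w,2r)\setminus\Omega$. Then the extended function belongs to $W^{1,p(\cdot)}_{loc}(B(w,2r))$, and there exists a unique finite positive (that is, non-negative) Borel measure $\mu$ on $\mathbb R^n$, supported on $\partial\Omega\cap B(w,r)$ in the sense that $\mu\big(\mathbb R^n\setminus(\partial\Omega\cap B(w,r))\big)=0$, such that for every $\psi\in C_0^\infty(B(w,r))$ the integral on the left below converges absolutely and $$\int_{\mathbb R^n}\langle|\nabla u|^{p(x)-2}\nabla u,\nabla\psi\rangle\,dx=-\int_{\mathbb R^n}\psi\,d\mu ,$$ where $\nabla u$ is the distributional gradient of the extended function. -/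

import Mathlib

open Set MeasureTheory
open scoped ContDiff

/-- `φ ∈ C₀^∞(D)`: smooth, real valued, with compact support contained in `D`. -/
structure IsTestFunction {n : ℕ} (D : Set (EuclideanSpace ℝ (Fin n)))
    (φ : EuclideanSpace ℝ (Fin n) → ℝ) : Prop where
  smooth : ContDiff ℝ ∞ φ
  compact : HasCompactSupport φ
  support_subset : tsupport φ ⊆ D

/-- Log-Hölder continuity with some constant `L > 0`: `|α x - α y| ≤ L / log (e + 1 / |x - y|)`.
For `x = y` the left side is `0` and the inequality holds under every reading of the right side. -/
def IsLogHolder {n : ℕ} (α : EuclideanSpace ℝ (Fin n) → ℝ) : Prop :=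
  ∃ L : ℝ, 0 < L ∧ ∀ x y : EuclideanSpace ℝ (Fin n),
    |α x - α y| ≤ L / Real.log (Real.exp 1 + 1 / ‖x - y‖)

/-- A bounded log-Hölder continuous variable exponent on `ℝⁿ`: `1 < p⁻ ≤ p x ≤ p⁺ < ∞` and
`1 / p` is log-Hölder continuous. -/
structure IsBoundedLogHolderExponent {n : ℕ} (p : EuclideanSpace ℝ (Fin n) → ℝ) : Prop where
  bounds : ∃ pm pp : ℝ, 1 < pm ∧ ∀ x, pm ≤ p x ∧ p x ≤ pp
  logHolder : IsLogHolder fun x => 1 / p x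

/-- The modular `∫_A |f(x)|^{p(x)} dx`, with values in `[0, ∞]`. -/
noncomputable def varModular {n : ℕ} {F : Type*} [NormedAddCommGroup F]
    (p : EuclideanSpace ℝ (Fin n) → ℝ) (A : Set (EuclideanSpace ℝ (Fin n)))
    (f : EuclideanSpace ℝ (Fin n) → F) : ENNReal :=
  ∫⁻ x in A, ENNReal.ofReal (‖f x‖ ^ p x)

/-- `f ∈ L^{p(·)}(A)`: `f` is measurable on `A` and the modular of `f / c` is finite for some
`c > 0`. -/
def MemVarLp {n : ℕ} {F : Type*} [NormedAddCommGroup F] [NormedSpace ℝ F]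
    (p : EuclideanSpace ℝ (Fin n) → ℝ) (A : Set (EuclideanSpace ℝ (Fin n)))
    (f : EuclideanSpace ℝ (Fin n) → F) : Prop :=
  AEStronglyMeasurable f (volume.restrict A) ∧
    ∃ c : ℝ, 0 < c ∧ varModular p A (fun x => c⁻¹ • f x) < ⊤

/-- `G` is the distributional gradient of `u` in the open set `D`:
`∫_D u ∇φ dx = - ∫_D φ G dx` for all `φ ∈ C₀^∞(D)`. -/
def IsWeakGradient {n : ℕ} (D : Set (EuclideanSpace ℝ (Fin n)))
    (u : EuclideanSpace ℝ (Fin n) → ℝ)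
    (G : EuclideanSpace ℝ (Fin n) → EuclideanSpace ℝ (Fin n)) : Prop :=
  LocallyIntegrableOn u D ∧ LocallyIntegrableOn G D ∧
    ∀ φ : EuclideanSpace ℝ (Fin n) → ℝ, IsTestFunction D φ →
      ∫ x in D, u x • gradient φ x = - ∫ x in D, φ x • G x

/-- `u ∈ W^{1,p(·)}_loc(D)` with distributional gradient `∇u = G`, for `D` open: both `u` and `G`
belong to `L^{p(·)}(K)` for every compact `K ⊆ D`. -/
def MemVarSobolevLoc {n : ℕ} (p : EuclideanSpace ℝ (Fin n) → ℝ)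
    (D : Set (EuclideanSpace ℝ (Fin n))) (u : EuclideanSpace ℝ (Fin n) → ℝ)
    (G : EuclideanSpace ℝ (Fin n) → EuclideanSpace ℝ (Fin n)) : Prop :=
  IsWeakGradient D u G ∧
    ∀ K : Set (EuclideanSpace ℝ (Fin n)), IsCompact K → K ⊆ D →
      MemVarLp p K u ∧ MemVarLp p K G

/-- The vector field `|G|^{p(x)-2} G`; it is `0` where `G = 0`, for every value of `p(x)`. -/
noncomputable def pxFlux {n : ℕ} (p : EuclideanSpace ℝ (Fin n) → ℝ)
    (G : EuclideanSpace ℝ (Fin n) → EuclideanSpace ℝ (Fin n)) (x : EuclideanSpace ℝ (Fin n)) :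
    EuclideanSpace ℝ (Fin n) :=
  ‖G x‖ ^ (p x - 2) • G x

/-- `u` is `p(·)`-harmonic in the open set `D`: a continuous function of class `W^{1,p(·)}_loc(D)`
with `∫_D ⟨|∇u|^{p(x)-2} ∇u, ∇φ⟩ dx = 0` for all `φ ∈ C₀^∞(D)`. -/
def IsPxHarmonic {n : ℕ} (p : EuclideanSpace ℝ (Fin n) → ℝ)
    (D : Set (EuclideanSpace ℝ (Fin n))) (u : EuclideanSpace ℝ (Fin n) → ℝ) : Prop :=
  ContinuousOn u D ∧
    ∃ G : EuclideanSpace ℝ (Fin n) → EuclideanSpace ℝ (Fin n),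
      MemVarSobolevLoc p D u G ∧
        ∀ φ : EuclideanSpace ℝ (Fin n) → ℝ, IsTestFunction D φ →
          ∫ x in D, inner ℝ (pxFlux p G x) (gradient φ x) = 0

/-! Write U for the ball of radius 2r, D = Ω ∩ U, and v for the extension of u by zero. Then v is
continuous on U and positive exactly on D. The proof tests the equation with Φ(v)η, where η ∈
C₀^∞(U) and Φ is smooth and vanishes on (-∞, ε]. Such a function has compact support in D even when
η does not, because supp η ∩ {v ≥ ε} is compact and contained in D.

It is admissible as a test function by mollifying v (`integral_truncation_eq_zero`). This is where
log-Hölder continuity enters: it bounds the p(·)-modular of mollified gradients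
(`exists_norm_mollify_rpow_le`). Strong convergence of these gradients is not needed. Young's
inequality with a small parameter and the modular bound suffice to pass to the limit
(`tendsto_integral_of_le_add_mul`).

Three uses of this identity, with constants independent of ε, give everything about v. Taking for Φ
a smooth positive part, with a power of a cutoff as η, gives a Caccioppoli bound, so ∇u has finite
energy up to ∂Ω (`integrableOn_rpow`). The same Φ with a constant vector field in place of the flux
shows that the zero extension of ∇u is the weak gradient of v on U (`memVarSobolevLoc`). Taking for
Φ a smooth step produces a term Φ'(v) η |∇u|^p ≥ 0; dropping it and letting ε → 0 shows that v is a
subsolution (`integral_inner_flux_nonpos`).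

Hence ψ ↦ -∫⟨flux, ∇ψ⟩ is a positive functional on C₀^∞(U), and after localisation by a cutoff it is
a measure (`exists_measure_of_nonneg`). The measure has no mass in Ω, where the equation holds, nor
off the closure of Ω, where the flux vanishes. Uniqueness holds because test functions determine a
finite measure on open sets. -/

open Filter Topology Metric

/-- Euclidean space of dimension `n`. -/
abbrev Rn (n : ℕ) : Type := EuclideanSpace ℝ (Fin n)

/-! ### The exponent -/

namespace IsBoundedLogHolderExponent

variable {n : ℕ} {p : Rn n → ℝ}

/-- The modulus of continuity passes from 1/p to p because p is bounded: p x - p y is -p x · p y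
times the difference of the reciprocals. -/
theorem exists_abs_sub_le (hp : IsBoundedLogHolderExponent p) :
    ∃ C : ℝ, 0 < C ∧ ∀ x y : Rn n,
      |p x - p y| ≤ C / Real.log (Real.exp 1 + 1 / ‖x - y‖) := by
  obtain ⟨pm, pp, hpm, hb⟩ := hp.bounds
  obtain ⟨L, hL, h⟩ := hp.logHolder
  have hpp : 0 < pp := by linarith [hb 0]
  refine ⟨pp * pp * L, by positivity, fun x y => ?_⟩
  have hx : 0 < p x := by linarith [hb x]
  have hy : 0 < p y := by linarith [hb y]
  have e : p x - p y = -(p x * p y * (1 / p x - 1 / p y)) := by field_simp; ring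
  rw [e, abs_neg, abs_mul, abs_of_pos (mul_pos hx hy), mul_div_assoc]
  gcongr
  · exact (hb x).2
  · exact (hb y).2
  · exact h x y

theorem exists_oscillation_le (hp : IsBoundedLogHolderExponent p) :
    ∃ C : ℝ, 0 < C ∧ ∀ δ : ℝ, 0 < δ → ∀ x y : Rn n, ‖x - y‖ ≤ δ →
      |p x - p y| * Real.log (Real.exp 1 + 1 / δ) ≤ C := by
  obtain ⟨C, hC, h⟩ := hp.exists_abs_sub_le
  refine ⟨C, hC, fun δ hδ x y hxy => ?_⟩
  rcases eq_or_ne x y with rfl | hne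
  · simpa using hC.le
  have hn : 0 < ‖x - y‖ := norm_pos_iff.2 (sub_ne_zero.2 hne)
  have he : 1 < Real.exp 1 := by simp
  have hle : Real.exp 1 + 1 / δ ≤ Real.exp 1 + 1 / ‖x - y‖ := by gcongr
  have h1 : 0 < Real.log (Real.exp 1 + 1 / δ) := Real.log_pos (by
    have : 0 < 1 / δ := by positivity
    linarith)
  rw [← le_div_iff₀ h1]
  refine (h x y).trans ?_
  gcongr

theorem continuous (hp : IsBoundedLogHolderExponent p) : Continuous p := by
  obtain ⟨C, hC, h⟩ := hp.exists_oscillation_le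
  rw [Metric.continuous_iff]
  intro y ε hε
  have hlim : Tendsto (fun δ : ℝ => Real.log (Real.exp 1 + 1 / δ)) (𝓝[>] 0) atTop := by
    refine Real.tendsto_log_atTop.comp (tendsto_atTop_add_const_left _ _ ?_)
    exact (tendsto_inv_nhdsGT_zero (𝕜 := ℝ)).congr fun x => (one_div x).symm
  obtain ⟨δ, h1, hδ⟩ :=
    ((hlim.eventually_gt_atTop (C / ε)).and self_mem_nhdsWithin).exists
  have hδ : 0 < δ := hδ
  refine ⟨δ, hδ, fun x hx => ?_⟩
  rw [dist_eq_norm] at hx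
  rw [Real.dist_eq]
  have h2 := h δ hδ x y hx.le
  have h3 : 0 < C / ε := by positivity
  rw [div_lt_iff₀ hε] at h1
  by_contra hcon
  push Not at hcon
  have : ε * Real.log (Real.exp 1 + 1 / δ) ≤ |p x - p y| * Real.log (Real.exp 1 + 1 / δ) := by
    gcongr
    exact Real.log_nonneg (by
      have : 0 < 1 / δ := by positivity
      have : 1 < Real.exp 1 := by simp
      linarith)
  linarith

/-- If t grows at most polynomially in 1/δ, then log t is at most a constant times log(e + 1/δ),
which the oscillation of p at scale δ cancels. So at that scale the exponents p x and p y are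
interchangeable up to a constant independent of δ. -/
theorem exists_rpow_sub_le (hp : IsBoundedLogHolderExponent p) {c : ℝ} (hc : 1 ≤ c) :
    ∃ C : ℝ, 0 ≤ C ∧ ∀ δ : ℝ, 0 < δ → ∀ x y : Rn n, ‖x - y‖ ≤ δ →
      ∀ t : ℝ, 1 ≤ t → t ≤ c * (1 / δ) ^ n → t ^ (p x - p y) ≤ C := by
  obtain ⟨C, hC, h⟩ := hp.exists_oscillation_le
  refine ⟨Real.exp (C * (Real.log c + n)), (Real.exp_pos _).le, fun δ hδ x y hxy t ht1 ht => ?_⟩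
  have hd : 0 < 1 / δ := by positivity
  have he : 1 < Real.exp 1 := by simp
  have hlog : 1 ≤ Real.log (Real.exp 1 + 1 / δ) := by
    rw [Real.le_log_iff_exp_le (by positivity)]; linarith
  have hosc := h δ hδ x y hxy
  have ht0 : 0 < t := by linarith
  have hlc : 0 ≤ Real.log c := Real.log_nonneg hc
  have h1 : Real.log t ≤ (Real.log c + n) * Real.log (Real.exp 1 + 1 / δ) := by
    calc Real.log t ≤ Real.log (c * (1 / δ) ^ n) := Real.log_le_log ht0 ht
      _ = Real.log c + n * Real.log (1 / δ) := by
          rw [Real.log_mul (by positivity) (by positivity), Real.log_pow]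
      _ ≤ Real.log c * Real.log (Real.exp 1 + 1 / δ)
            + n * Real.log (Real.exp 1 + 1 / δ) := by
          gcongr
          · exact le_mul_of_one_le_right hlc hlog
          · linarith
      _ = _ := by ring
  rw [Real.rpow_def_of_pos ht0]
  apply Real.exp_le_exp.2
  calc Real.log t * (p x - p y) ≤ Real.log t * |p x - p y| := by
        gcongr
        · exact Real.log_nonneg ht1
        · exact le_abs_self _
    _ ≤ ((Real.log c + n) * Real.log (Real.exp 1 + 1 / δ)) * |p x - p y| := by gcongr
    _ = (|p x - p y| * Real.log (Real.exp 1 + 1 / δ)) * (Real.log c + n) := by ring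
    _ ≤ C * (Real.log c + n) := by gcongr

end IsBoundedLogHolderExponent

/-! ### Elementary inequalities -/

/-- For a ≥ t, write a = a^q · a^(1-q) and use 1 - q ≤ 0. Splitting at a threshold t replaces
Jensen's inequality when the exponent varies from point to point. -/
theorem le_add_rpow_mul_rpow {a t q : ℝ} (ha : 0 ≤ a) (ht : 0 < t) (hq : 1 ≤ q) :
    a ≤ t + a ^ q * t ^ (1 - q) := by
  rcases le_total a t with h | h
  · have : 0 ≤ a ^ q * t ^ (1 - q) := by positivity
    linarith
  · have ha' : 0 < a := by linarith
    have h1 : t ^ (q - 1) ≤ a ^ (q - 1) := Real.rpow_le_rpow ht.le h (by linarith)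
    have h2 : a = a ^ q * a ^ (1 - q) := by
      rw [← Real.rpow_add ha']; simp
    have h3 : a ^ (1 - q) ≤ t ^ (1 - q) :=
      Real.rpow_le_rpow_of_nonpos ht h (by linarith)
    calc a = a ^ q * a ^ (1 - q) := h2
      _ ≤ a ^ q * t ^ (1 - q) := by gcongr
      _ ≤ _ := by linarith

/-- Young's inequality with a small parameter, by cases on whether a ≤ τ b^(q-1). The constant
depends on the exponent only through its lower bound m, so it is uniform when q = p(x); this uses τ
≤ 1. -/
theorem mul_le_conjugate_rpow_add {a b τ q m : ℝ} (ha : 0 ≤ a) (hb : 0 ≤ b) (hτ : 0 < τ)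
    (hτ1 : τ ≤ 1) (hm : 1 < m) (hq : m ≤ q) :
    a * b ≤ τ ^ (-(1 / (m - 1))) * a ^ (q / (q - 1)) + τ * b ^ q := by
  have hq1 : 0 < q - 1 := by linarith
  have hm1 : 0 < m - 1 := by linarith
  rcases le_total a (τ * b ^ (q - 1)) with h | h
  · have h1 : a * b ≤ τ * b ^ q := by
      calc a * b ≤ τ * b ^ (q - 1) * b := by gcongr
        _ = τ * b ^ q := by
          rcases hb.eq_or_lt with rfl | hb'
          · simp [Real.zero_rpow (by linarith : q ≠ 0)]
          · rw [mul_assoc, ← Real.rpow_add_one hb'.ne']; simp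
    have : 0 ≤ τ ^ (-(1 / (m - 1))) * a ^ (q / (q - 1)) := by positivity
    linarith
  · have h1 : b ≤ (a / τ) ^ (1 / (q - 1)) := by
      have : b ^ (q - 1) ≤ a / τ := by rw [le_div_iff₀ hτ]; linarith
      calc b = (b ^ (q - 1)) ^ (1 / (q - 1)) := by
            rw [← Real.rpow_mul hb, mul_one_div_cancel hq1.ne', Real.rpow_one]
        _ ≤ _ := Real.rpow_le_rpow (by positivity) this (by positivity)
    have h2 : (a / τ) ^ (1 / (q - 1)) = τ ^ (-(1 / (q - 1))) * a ^ (1 / (q - 1)) := by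
      rw [Real.div_rpow ha hτ.le, Real.rpow_neg hτ.le]; field_simp
    have h3 : τ ^ (-(1 / (q - 1))) ≤ τ ^ (-(1 / (m - 1))) := by
      apply Real.rpow_le_rpow_of_exponent_ge hτ hτ1
      apply neg_le_neg
      apply one_div_le_one_div_of_le hm1; linarith
    have h4 : a * a ^ (1 / (q - 1)) = a ^ (q / (q - 1)) := by
      rcases ha.eq_or_lt with rfl | ha'
      · rw [zero_mul, Real.zero_rpow (div_ne_zero (by linarith) hq1.ne')]
      · rw [mul_comm, ← Real.rpow_add_one ha'.ne']
        congr 1; field_simp; ring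
    calc a * b ≤ a * (τ ^ (-(1 / (m - 1))) * a ^ (1 / (q - 1))) := by
          gcongr
          rw [h2] at h1
          exact h1.trans (by gcongr)
      _ = τ ^ (-(1 / (m - 1))) * a ^ (q / (q - 1)) := by rw [← h4]; ring
      _ ≤ _ := by
        have : 0 ≤ τ * b ^ q := by positivity
        linarith

theorem le_one_add_rpow {a q : ℝ} (ha : 0 ≤ a) (hq : 1 ≤ q) : a ≤ 1 + a ^ q := by
  simpa using le_add_rpow_mul_rpow ha one_pos hq

/-! ### A convergence theorem -/

theorem abs_sub_clamp_le {a b f : ℝ} (ha : 0 ≤ a) (hb : 0 ≤ b) (h : |f| ≤ a + b) :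
    |f - max (-a) (min a f)| ≤ b := by
  grind

/-- Clamping the functions to [-a, a] makes dominated convergence applicable, and the clamping error
is at most τ b, of integral at most τ N. The arbitrariness of τ plays the role of uniform
integrability. -/
theorem tendsto_integral_of_le_add_mul {α : Type*} [MeasurableSpace α] {μ : Measure α}
    {f : ℕ → α → ℝ} {g : α → ℝ} {b : ℕ → α → ℝ} {b' : α → ℝ} {N : ℝ}
    (hf : ∀ i, AEStronglyMeasurable (f i) μ) (hg : AEStronglyMeasurable g μ)
    (hb : ∀ i, Integrable (b i) μ) (hb' : Integrable b' μ)
    (hb0 : ∀ i x, 0 ≤ b i x) (hb0' : ∀ x, 0 ≤ b' x)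
    (hN : ∀ i, ∫ x, b i x ∂μ ≤ N) (hN' : ∫ x, b' x ∂μ ≤ N)
    (h : ∀ τ : ℝ, 0 < τ → τ ≤ 1 → ∃ a : α → ℝ, Integrable a μ ∧ (∀ x, 0 ≤ a x) ∧
      (∀ i, ∀ᵐ x ∂μ, |f i x| ≤ a x + τ * b i x) ∧ ∀ᵐ x ∂μ, |g x| ≤ a x + τ * b' x)
    (hlim : ∀ᵐ x ∂μ, Tendsto (fun i => f i x) atTop (𝓝 (g x))) :
    Integrable g μ ∧ Tendsto (fun i => ∫ x, f i x ∂μ) atTop (𝓝 (∫ x, g x ∂μ)) := by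
  have key : ∀ {a c e : α → ℝ} {τ : ℝ}, 0 < τ → Integrable a μ → Integrable c μ →
      AEStronglyMeasurable e μ → (∀ᵐ x ∂μ, |e x| ≤ a x + τ * c x) → Integrable e μ :=
    fun {a c e τ} _ ha hc he hle => (ha.add (hc.const_mul τ)).mono' he hle
  have hN0 : 0 ≤ N := (integral_nonneg hb0').trans hN'
  obtain ⟨a, ha, -, ha1, ha2⟩ := h 1 one_pos le_rfl
  have hfi : ∀ i, Integrable (f i) μ := fun i => key one_pos ha (hb i) (hf i) (ha1 i)
  have hgi : Integrable g μ := key one_pos ha hb' hg ha2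
  refine ⟨hgi, ?_⟩
  rw [Metric.tendsto_atTop]
  intro ε hε
  obtain ⟨τ, hτ, hτ1, hτN⟩ : ∃ τ : ℝ, 0 < τ ∧ τ ≤ 1 ∧ τ * N < ε / 3 := by
    refine ⟨min 1 (ε / (3 * (N + 1))), by positivity, min_le_left _ _, ?_⟩
    calc min 1 (ε / (3 * (N + 1))) * N ≤ ε / (3 * (N + 1)) * N := by gcongr; exact min_le_right _ _
      _ < ε / (3 * (N + 1)) * (N + 1) := by gcongr; linarith
      _ = ε / 3 := by field_simp
  obtain ⟨a, ha, ha0, ha1, ha2⟩ := h τ hτ hτ1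
  have hcm : ∀ {e : α → ℝ}, AEStronglyMeasurable e μ →
      AEStronglyMeasurable (fun x => max (-a x) (min (a x) (e x))) μ := fun he =>
    (ha.1.neg).sup (ha.1.inf he)
  have hcb : ∀ (e : α → ℝ) x, ‖max (-a x) (min (a x) (e x))‖ ≤ a x := fun e x => by
    rw [Real.norm_eq_abs, abs_le]
    exact ⟨le_max_left _ _, max_le (by linarith [ha0 x]) (min_le_left _ _)⟩
  have hci : ∀ {e : α → ℝ}, AEStronglyMeasurable e μ →
      Integrable (fun x => max (-a x) (min (a x) (e x))) μ := fun he =>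
    ha.mono' (hcm he) (Eventually.of_forall (hcb _))
  have hclose : ∀ {e c : α → ℝ}, Integrable e μ → Integrable c μ → (∀ x, 0 ≤ c x) →
      ∫ x, c x ∂μ ≤ N → (∀ᵐ x ∂μ, |e x| ≤ a x + τ * c x) →
      |∫ x, e x ∂μ - ∫ x, max (-a x) (min (a x) (e x)) ∂μ| < ε / 3 := by
    intro e c he hc hc0 hcN hle
    rw [← integral_sub he (hci he.1)]
    refine lt_of_le_of_lt ?_ hτN
    calc |∫ x, (e x - max (-a x) (min (a x) (e x))) ∂μ|
        ≤ ∫ x, τ * c x ∂μ := by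
          refine norm_integral_le_of_norm_le (G := ℝ) (hc.const_mul τ) ?_
          filter_upwards [hle] with x hx
          exact abs_sub_clamp_le (ha0 x) (mul_nonneg hτ.le (hc0 x)) hx
      _ = τ * ∫ x, c x ∂μ := integral_const_mul _ _
      _ ≤ τ * N := by gcongr
  have hdct : Tendsto (fun i => ∫ x, max (-a x) (min (a x) (f i x)) ∂μ) atTop
      (𝓝 (∫ x, max (-a x) (min (a x) (g x)) ∂μ)) := by
    refine tendsto_integral_of_dominated_convergence a (fun i => hcm (hf i)) ha
      (fun i => Eventually.of_forall (hcb _)) ?_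
    filter_upwards [hlim] with x hx
    exact tendsto_const_nhds.max (tendsto_const_nhds.min hx)
  obtain ⟨i₀, hi₀⟩ := Metric.tendsto_atTop.1 hdct (ε / 3) (by positivity)
  refine ⟨i₀, fun i hi => ?_⟩
  have h1 := hclose (hfi i) (hb i) (hb0 i) (hN i) (ha1 i)
  have h2 := hclose hgi hb' hb0' hN' ha2
  have h3 := hi₀ i hi
  rw [Real.dist_eq] at h3 ⊢
  rw [abs_lt] at *
  constructor <;> linarith

/-! ### Mollification -/

section Mollification

variable {n : ℕ}

/-- The mollification of `g` by the normalised bump function `φ`. -/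
noncomputable def mollify {F : Type*} [NormedAddCommGroup F] [NormedSpace ℝ F]
    (φ : ContDiffBump (0 : Rn n)) (g : Rn n → F) : Rn n → F :=
  convolution (φ.normed volume) g (ContinuousLinearMap.lsmul ℝ ℝ) volume

variable {F : Type*} [NormedAddCommGroup F] [NormedSpace ℝ F]

theorem mollify_apply (φ : ContDiffBump (0 : Rn n)) (g : Rn n → F) (x : Rn n) :
    mollify φ g x = ∫ y, φ.normed volume (x - y) • g y := by
  rw [mollify, convolution_eq_swap]; rfl

theorem integrable_mollify {φ : ContDiffBump (0 : Rn n)} {g : Rn n → F} (hg : Integrable g) :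
    Integrable (mollify φ g) :=
  φ.integrable_normed.integrable_convolution _ hg

theorem integrable_normed_sub_smul {φ : ContDiffBump (0 : Rn n)} {g : Rn n → F}
    (hg : Integrable g) (x : Rn n) : Integrable fun y => φ.normed volume (x - y) • g y := by
  refine hg.bdd_smul (C := 1 / volume.real (closedBall (0 : Rn n) φ.rIn)) ?_ ?_
  · exact (φ.continuous_normed.comp (continuous_const.sub continuous_id)).aestronglyMeasurable
  · refine Eventually.of_forall fun y => ?_
    rw [Real.norm_eq_abs, abs_of_nonneg (φ.nonneg_normed _)]
    exact φ.normed_le_div_measure_closedBall_rIn _ _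

theorem integral_mollify {φ : ContDiffBump (0 : Rn n)} {g : Rn n → ℝ} (hg : Integrable g) :
    ∫ x, mollify φ g x = ∫ x, g x := by
  rw [mollify, integral_convolution _ φ.integrable_normed hg, φ.integral_normed]
  simp

theorem mollify_nonneg (φ : ContDiffBump (0 : Rn n)) {g : Rn n → ℝ} (hg : ∀ x, 0 ≤ g x)
    (x : Rn n) : 0 ≤ mollify φ g x := by
  rw [mollify_apply]
  exact integral_nonneg fun y => smul_nonneg (φ.nonneg_normed _) (hg y)

theorem norm_mollify_le {φ : ContDiffBump (0 : Rn n)} (g : Rn n → F) (x : Rn n) :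
    ‖mollify φ g x‖ ≤ mollify φ (fun y => ‖g y‖) x := by
  rw [mollify_apply, mollify_apply]
  refine (norm_integral_le_integral_norm _).trans (le_of_eq ?_)
  congr 1; ext y
  rw [norm_smul, Real.norm_eq_abs, abs_of_nonneg (φ.nonneg_normed _), smul_eq_mul]

/-- The kernel is at most a constant times rOut^(-n), since rIn ≥ rOut / 2; the summand 1 is
absorbed because rOut ≤ 1. This is the polynomial growth that `exists_rpow_sub_le` requires. -/
theorem exists_one_add_mollify_le {g : Rn n → ℝ} (hg : Integrable g) (hg0 : ∀ x, 0 ≤ g x) :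
    ∃ c : ℝ, 1 ≤ c ∧ ∀ φ : ContDiffBump (0 : Rn n), φ.rOut ≤ 1 → φ.rOut ≤ 2 * φ.rIn → ∀ x,
      1 + mollify φ g x ≤ c * (1 / φ.rOut) ^ n := by
  set m := volume.real (ball (0 : Rn n) 1) with hm
  have hm0 : 0 < m := by
    rw [hm, measureReal_def]
    exact ENNReal.toReal_pos (measure_ball_pos _ _ one_pos).ne' measure_ball_lt_top.ne
  have hI : 0 ≤ ∫ y, g y := integral_nonneg hg0
  refine ⟨1 + 2 ^ n / m * ∫ y, g y, by
    have : 0 ≤ 2 ^ n / m * ∫ y, g y := by positivity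
    linarith, fun φ h1 h2 x => ?_⟩
  have hr := φ.rOut_pos
  have hri := φ.rIn_pos
  have hvol : volume.real (closedBall (0 : Rn n) φ.rIn) = φ.rIn ^ n * m := by
    rw [hm, measureReal_def, measureReal_def, Measure.addHaar_closedBall _ _ hri.le,
      ENNReal.toReal_mul, ENNReal.toReal_ofReal (by positivity)]
    simp
  have hρ : ∀ z, φ.normed volume z ≤ 2 ^ n / m * (1 / φ.rOut) ^ n := fun z => by
    refine (φ.normed_le_div_measure_closedBall_rIn volume z).trans ?_
    rw [hvol]
    calc 1 / (φ.rIn ^ n * m) ≤ 1 / ((φ.rOut / 2) ^ n * m) := by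
          gcongr; linarith
      _ = _ := by rw [div_pow, div_pow, one_pow]; field_simp
  have h3 : mollify φ g x ≤ 2 ^ n / m * (1 / φ.rOut) ^ n * ∫ y, g y := by
    rw [mollify_apply, ← integral_const_mul]
    refine integral_mono (integrable_normed_sub_smul hg x) (hg.const_mul _) fun y => ?_
    exact mul_le_mul_of_nonneg_right (hρ _) (hg0 y)
  have h4 : 1 ≤ (1 / φ.rOut) ^ n := one_le_pow₀ (by rw [le_div_iff₀ hr]; linarith)
  calc _ ≤ (1 / φ.rOut) ^ n + 2 ^ n / m * (1 / φ.rOut) ^ n * ∫ y, g y := add_le_add h4 h3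
    _ = _ := by ring

/-- Pointwise modular estimate for mollifications in a log-Hölder variable exponent space. -/
theorem exists_norm_mollify_rpow_le {p : Rn n → ℝ} (hp : IsBoundedLogHolderExponent p)
    {g : Rn n → F} (hg : Integrable g) (hgp : Integrable fun y => ‖g y‖ ^ p y) :
    ∃ C : ℝ, 0 ≤ C ∧ ∀ φ : ContDiffBump (0 : Rn n), φ.rOut ≤ 1 → φ.rOut ≤ 2 * φ.rIn → ∀ x,
      ‖mollify φ g x‖ ^ p x ≤ C * (1 + mollify φ (fun y => ‖g y‖ ^ p y) x) := by
  obtain ⟨pm, pp, hpm, hb⟩ := hp.bounds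
  have hgp0 : ∀ y, 0 ≤ ‖g y‖ ^ p y := fun y => by positivity
  obtain ⟨c, hc1, hc⟩ := exists_one_add_mollify_le hgp hgp0
  obtain ⟨C, hC0, hC⟩ := hp.exists_rpow_sub_le hc1
  refine ⟨(1 + C) ^ pp, by positivity, fun φ h1 h2 x => ?_⟩
  set M := 1 + mollify φ (fun y => ‖g y‖ ^ p y) x with hM
  have hM1 : 1 ≤ M := by linarith [mollify_nonneg φ hgp0 x]
  have hpx : 1 < p x := by linarith [hb x]
  -- The threshold is chosen so that t^(p x) = M. Both terms of the splitting below then integrate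
  -- to at most a multiple of t.
  set t := M ^ (1 / p x) with ht
  have ht1 : 1 ≤ t := Real.one_le_rpow hM1 (by positivity)
  have ht0 : 0 < t := by linarith
  have htM : t ≤ M := by
    calc t ≤ M ^ (1 : ℝ) := Real.rpow_le_rpow_of_exponent_le hM1
          (by rw [div_le_one (by linarith)]; linarith)
      _ = M := Real.rpow_one M
  have htp : t ^ p x = M := by
    rw [ht, ← Real.rpow_mul (by linarith), one_div_mul_cancel (by linarith), Real.rpow_one]
  have hpt : ∀ y, φ.normed volume (x - y) • ‖g y‖ ≤
      t * φ.normed volume (x - y) +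
        (C * t ^ (1 - p x)) * (φ.normed volume (x - y) • ‖g y‖ ^ p y) := by
    intro y
    by_cases hy : x - y ∈ ball (0 : Rn n) φ.rOut
    · have hy' : ‖x - y‖ ≤ φ.rOut := by simpa using (mem_ball_zero_iff.1 hy).le
      have hpy : 1 ≤ p y := by linarith [hb y]
      have e1 := le_add_rpow_mul_rpow (norm_nonneg (g y)) ht0 hpy
      -- Freezing the exponent: y lies within rOut of x and t ≤ M grows polynomially in 1/rOut, so p
      -- y may be replaced by p x.
      have e2 : t ^ (1 - p y) ≤ C * t ^ (1 - p x) := by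
        have : t ^ (1 - p y) = t ^ (p x - p y) * t ^ (1 - p x) := by
          rw [← Real.rpow_add ht0]; congr 1; ring
        rw [this]
        gcongr
        exact hC φ.rOut φ.rOut_pos x y hy' t ht1 (htM.trans (hc φ h1 h2 x))
      have e3 : ‖g y‖ ≤ t + ‖g y‖ ^ p y * (C * t ^ (1 - p x)) := e1.trans (by gcongr)
      have e4 := mul_le_mul_of_nonneg_left e3 (φ.nonneg_normed (μ := volume) (x - y))
      simp only [smul_eq_mul]
      linarith
    · have : φ.normed volume (x - y) = 0 := by
        rw [← φ.support_normed_eq (μ := volume)] at hy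
        simpa using hy
      simp [this]
  have hint : ∫ y, φ.normed volume (x - y) = 1 := by
    rw [integral_sub_left_eq_self (fun y => φ.normed volume y), φ.integral_normed]
  have hint' : Integrable fun y => φ.normed volume (x - y) :=
    φ.integrable_normed.comp_sub_left x
  have hle : mollify φ (fun y => ‖g y‖) x ≤ t * (1 + C) := by
    rw [mollify_apply]
    calc _ ≤ ∫ y, (t * φ.normed volume (x - y) +
        (C * t ^ (1 - p x)) * (φ.normed volume (x - y) • ‖g y‖ ^ p y)) :=
          integral_mono (integrable_normed_sub_smul hg.norm x)
            ((hint'.const_mul _).add ((integrable_normed_sub_smul hgp x).const_mul _)) hpt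
      _ = t + C * t ^ (1 - p x) * mollify φ (fun y => ‖g y‖ ^ p y) x := by
          rw [integral_add (hint'.const_mul _) ((integrable_normed_sub_smul hgp x).const_mul _),
            integral_const_mul, integral_const_mul, hint, mollify_apply, mul_one]
      _ ≤ t + C * t ^ (1 - p x) * M := by gcongr; linarith
      _ = t + C * t := by
          rw [← htp, mul_assoc, ← Real.rpow_add ht0]; simp
      _ = _ := by ring
  calc ‖mollify φ g x‖ ^ p x ≤ (t * (1 + C)) ^ p x := by
        gcongr
        exact (norm_mollify_le g x).trans hle
    _ = M * (1 + C) ^ p x := by rw [Real.mul_rpow ht0.le (by linarith), htp]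
    _ ≤ M * (1 + C) ^ pp := by
        gcongr
        · linarith
        · exact (hb x).2
    _ = _ := by ring

theorem contDiff_mollify (φ : ContDiffBump (0 : Rn n)) {g : Rn n → F} (hg : LocallyIntegrable g) :
    ContDiff ℝ ∞ (mollify φ g) :=
  φ.hasCompactSupport_normed.contDiff_convolution_left _ φ.contDiff_normed hg

theorem continuous_gradient_of_contDiff {f : Rn n → ℝ} (hf : ContDiff ℝ ∞ f) :
    Continuous (gradient f) :=
  (InnerProductSpace.toDual ℝ (Rn n)).symm.continuous.comp (hf.continuous_fderiv (by simp))

theorem gradient_eq_zero_of_notMem_tsupport {f : Rn n → ℝ} {x : Rn n} (hx : x ∉ tsupport f) :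
    gradient f x = 0 := by
  rw [gradient, fderiv_of_notMem_tsupport ℝ hx, map_zero]

theorem hasCompactSupport_gradient {f : Rn n → ℝ} (hf : HasCompactSupport f) :
    HasCompactSupport (gradient f) :=
  HasCompactSupport.intro hf fun _ => gradient_eq_zero_of_notMem_tsupport

theorem integrable_smul_gradient_normed (φ : ContDiffBump (0 : Rn n)) {g : Rn n → ℝ}
    (hg : Integrable g) (x : Rn n) :
    Integrable fun y => g y • gradient (φ.normed volume) (x - y) := by
  have hc : Continuous fun y => gradient (φ.normed volume) (x - y) :=
    (continuous_gradient_of_contDiff φ.contDiff_normed).comp (continuous_const.sub continuous_id)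
  obtain ⟨C, hC⟩ := (continuous_gradient_of_contDiff (φ.contDiff_normed)).bounded_above_of_compact_support
    (hasCompactSupport_gradient (φ.hasCompactSupport_normed (μ := volume)))
  exact hg.smul_bdd (C := C) hc.aestronglyMeasurable (Eventually.of_forall fun y => hC _)

theorem gradient_mollify (φ : ContDiffBump (0 : Rn n)) {g : Rn n → ℝ} (hg : Integrable g)
    (x : Rn n) :
    gradient (mollify φ g) x = ∫ y, g y • gradient (φ.normed volume) (x - y) := by
  have hint := integrable_smul_gradient_normed φ hg x
  have h := φ.hasCompactSupport_normed (μ := volume).hasFDerivAt_convolution_left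
    (ContinuousLinearMap.lsmul ℝ ℝ) (φ.contDiff_normed (n := 1)) hg.locallyIntegrable x
  rw [gradient, mollify, h.fderiv, LinearIsometryEquiv.symm_apply_eq, convolution_eq_swap]
  refine Eq.trans ?_
    ((InnerProductSpace.toDual ℝ (Rn n)).toContinuousLinearEquiv.integral_comp_comm _)
  refine integral_congr_ae (Eventually.of_forall fun y => ?_)
  ext v
  simp [gradient, mul_comm]

/-- Inside the domain, the mollification of a weakly differentiable function has the mollified
weak gradient as its gradient. -/
theorem gradient_mollify_eq {D : Set (Rn n)} {v v' : Rn n → ℝ} {G G' : Rn n → Rn n}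
    (hG : IsWeakGradient D v G) (φ : ContDiffBump (0 : Rn n)) {x : Rn n}
    (hx : closedBall x φ.rOut ⊆ D) (hv' : Integrable v')
    (hvv : ∀ y ∈ closedBall x φ.rOut, v' y = v y) (hGG : ∀ y ∈ closedBall x φ.rOut, G' y = G y) :
    gradient (mollify φ v') x = mollify φ G' x := by
  have hsupp : tsupport (fun y => φ.normed volume (x - y)) ⊆ closedBall x φ.rOut := by
    refine closure_minimal (fun y hy => ?_) isClosed_closedBall
    have : x - y ∈ Function.support (φ.normed volume) := hy
    rw [φ.support_normed_eq, mem_ball_zero_iff] at this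
    rw [mem_closedBall, dist_comm, dist_eq_norm]
    exact this.le
  have hzero : ∀ y ∉ closedBall x φ.rOut, φ.normed volume (x - y) = 0 := fun y hy => by
    by_contra h
    exact hy (hsupp (subset_closure h))
  have hgz : ∀ y ∉ closedBall x φ.rOut, gradient (φ.normed volume) (x - y) = 0 := fun y hy => by
    apply gradient_eq_zero_of_notMem_tsupport
    rw [φ.tsupport_normed_eq, mem_closedBall_zero_iff]
    rwa [mem_closedBall, dist_comm, dist_eq_norm] at hy
  have htest : IsTestFunction D fun y => φ.normed volume (x - y) :=
    ⟨φ.contDiff_normed.comp (contDiff_const.sub contDiff_id),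
      (isCompact_closedBall x φ.rOut).of_isClosed_subset (isClosed_tsupport _) hsupp,
      hsupp.trans hx⟩
  have hgrad : ∀ y, gradient (fun y => φ.normed volume (x - y)) y =
      -gradient (φ.normed volume) (x - y) := fun y => by
    rw [gradient, gradient, ← map_neg]
    congr 1
    have h := ((φ.contDiff_normed (μ := volume) (n := 1)).differentiable (by simp)
      (x - y)).hasFDerivAt.comp y ((hasFDerivAt_id y).const_sub x)
    refine h.fderiv.trans ?_
    ext v
    simp
  -- The reflected kernel centred at x is itself a test function in D; the definition of the weak
  -- gradient, applied to it, is the claim up to signs.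
  have h := hG.2.2 _ htest
  rw [gradient_mollify φ hv', mollify_apply]
  simp only [hgrad, smul_neg, integral_neg, neg_inj] at h
  rw [setIntegral_eq_integral_of_forall_compl_eq_zero (fun y hy => by
      rw [hgz y fun h => hy (hx h), smul_zero]),
    setIntegral_eq_integral_of_forall_compl_eq_zero (fun y hy => by
      rw [hzero y fun h => hy (hx h), zero_smul])] at h
  convert h using 2
  · ext1 y
    by_cases hy : y ∈ closedBall x φ.rOut
    · rw [hvv y hy]
    · rw [hgz y hy, smul_zero, smul_zero]
  · ext1 y
    by_cases hy : y ∈ closedBall x φ.rOut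
    · rw [hGG y hy]
    · rw [hzero y hy, zero_smul, zero_smul]

end Mollification

/-! ### Testing with truncations of a Sobolev function -/

section Truncation

variable {n : ℕ}

theorem gradient_comp_mul {Φ : ℝ → ℝ} {f η : Rn n → ℝ} {x : Rn n}
    (hΦ : DifferentiableAt ℝ Φ (f x)) (hf : DifferentiableAt ℝ f x)
    (hη : DifferentiableAt ℝ η x) :
    gradient (fun y => Φ (f y) * η y) x =
      (deriv Φ (f x) * η x) • gradient f x + Φ (f x) • gradient η x := by
  have h1 : HasFDerivAt (fun y => Φ (f y)) (deriv Φ (f x) • fderiv ℝ f x) x :=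
    hΦ.hasDerivAt.comp_hasFDerivAt x hf.hasFDerivAt
  have h := h1.mul hη.hasFDerivAt
  rw [gradient, show (fun y => Φ (f y) * η y) = (fun y => Φ (f y)) * η from rfl, h.fderiv]
  simp only [gradient, map_add, map_smul, smul_smul]
  rw [add_comm, mul_comm]

theorem gradient_add {φ ψ : Rn n → ℝ} {x : Rn n} (hφ : DifferentiableAt ℝ φ x)
    (hψ : DifferentiableAt ℝ ψ x) :
    gradient (fun y => φ y + ψ y) x = gradient φ x + gradient ψ x := by
  rw [gradient, fderiv_fun_add hφ hψ, map_add]; rfl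

theorem gradient_const_mul {φ : Rn n → ℝ} {x : Rn n} (hφ : DifferentiableAt ℝ φ x) (c : ℝ) :
    gradient (fun y => c * φ y) x = c • gradient φ x := by
  rw [gradient, fderiv_const_mul hφ, map_smul]; rfl

/-- Young's inequality with parameter τ / c handles the Y term, so the factor c leaves exactly τ.
The Z term is bounded and costs only a multiple of ‖X‖ ≤ 1 + ‖X‖^(q/(q-1)). This is the majorant fed
to `tendsto_integral_of_le_add_mul`. -/
theorem abs_inner_le_conjugate_rpow_add {E : Type*} [NormedAddCommGroup E] [InnerProductSpace ℝ E]
    {a b c τ q m : ℝ} {X Y Z : E} (hc : 1 ≤ c) (hτ : 0 < τ) (hτ1 : τ ≤ 1) (hm : 1 < m)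
    (hq : m ≤ q) (ha : |a| ≤ c) (hZ : ‖b • Z‖ ≤ c) :
    |inner ℝ X (a • Y + b • Z)| ≤
      c * (1 + ‖X‖ ^ (q / (q - 1))) + c * (τ / c) ^ (-(1 / (m - 1))) * ‖X‖ ^ (q / (q - 1))
        + τ * ‖Y‖ ^ q := by
  have hc0 : 0 < c := by linarith
  have h1 := mul_le_conjugate_rpow_add (norm_nonneg X) (norm_nonneg Y) (div_pos hτ hc0)
    ((div_le_one hc0).2 (hτ1.trans hc)) hm hq
  have h2 := le_one_add_rpow (norm_nonneg X) (q := q / (q - 1))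
    (by rw [le_div_iff₀ (by linarith)]; linarith)
  calc |inner ℝ X (a • Y + b • Z)| ≤ ‖X‖ * ‖a • Y + b • Z‖ := abs_real_inner_le_norm _ _
    _ ≤ ‖X‖ * (c * ‖Y‖ + c) := by
        gcongr
        refine (norm_add_le _ _).trans (add_le_add ?_ hZ)
        rw [norm_smul, Real.norm_eq_abs]
        gcongr
    _ = c * ‖X‖ + c * (‖X‖ * ‖Y‖) := by ring
    _ ≤ c * (1 + ‖X‖ ^ (q / (q - 1))) + c * ((τ / c) ^ (-(1 / (m - 1))) * ‖X‖ ^ (q / (q - 1))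
          + τ / c * ‖Y‖ ^ q) := by gcongr
    _ = _ := by field_simp; ring

theorem exists_mollifier_seq {δ : ℝ} (hδ : 0 < δ) :
    ∃ φ : ℕ → ContDiffBump (0 : Rn n), Tendsto (fun k => (φ k).rOut) atTop (𝓝 0) ∧
      (∀ k, (φ k).rOut ≤ 2 * (φ k).rIn) ∧ ∀ k, (φ k).rOut < δ := by
  have hk : ∀ k : ℕ, 0 < δ / ((k : ℝ) + 2) := fun k => by positivity
  refine ⟨fun k => ⟨δ / (k + 2) / 2, δ / (k + 2), by linarith [hk k], by linarith [hk k]⟩,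
    ?_, fun k => ?_, fun k => ?_⟩
  · exact tendsto_const_nhds.div_atTop
      (tendsto_atTop_add_const_right _ _ tendsto_natCast_atTop_atTop)
  · show δ / ((k : ℝ) + 2) ≤ 2 * (δ / (k + 2) / 2)
    linarith
  · show δ / ((k : ℝ) + 2) < δ
    apply div_lt_self hδ
    have : (0 : ℝ) ≤ k := by positivity
    linarith

/-- Mollify v, test the equation with Φ(f k) η, and pass to the limit. The field B is any
divergence-free field locally in the conjugate space: the flux gives the energy and subsolution
estimates, a constant field gives the weak gradient of the extension. -/
theorem integral_truncation_eq_zero {p : Rn n → ℝ} (hp : IsBoundedLogHolderExponent p)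
    {U D : Set (Rn n)} (hU : IsOpen U) (hD : IsOpen D) {v : Rn n → ℝ} (hv : ContinuousOn v U)
    (hvD : ∀ x ∈ U, 0 < v x → x ∈ D) {G : Rn n → Rn n} (hG : IsWeakGradient D v G)
    (hGp : ∀ K, IsCompact K → K ⊆ D → IntegrableOn (fun x => ‖G x‖ ^ p x) K)
    {B : Rn n → Rn n} (hBm : AEStronglyMeasurable B (volume.restrict D))
    (hBp : ∀ K, IsCompact K → K ⊆ D → IntegrableOn (fun x => ‖B x‖ ^ (p x / (p x - 1))) K)
    (hB : ∀ φ, IsTestFunction D φ → ∫ x in D, inner ℝ (B x) (gradient φ x) = 0)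
    {Φ : ℝ → ℝ} (hΦ : ContDiff ℝ ∞ Φ) {ε : ℝ} (hε : 0 < ε) (hΦ0 : ∀ t ≤ ε, Φ t = 0)
    {η : Rn n → ℝ} (hη : IsTestFunction U η) :
    IntegrableOn (fun x => inner ℝ (B x)
      ((deriv Φ (v x) * η x) • G x + Φ (v x) • gradient η x)) D ∧
    ∫ x in D, inner ℝ (B x) ((deriv Φ (v x) * η x) • G x + Φ (v x) • gradient η x) = 0 := by
  obtain ⟨pm, pp, hpm, hb⟩ := hp.bounds
  have hpc := hp.continuous
  have hdΦ : Continuous (deriv Φ) := hΦ.continuous_deriv (by simp)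
  have hgη := continuous_gradient_of_contDiff hη.smooth
  -- neighbourhoods on which everything is integrable
  set K := tsupport η with hKdef
  have hK : IsCompact K := hη.compact
  obtain ⟨δ₀, hδ₀, hδ₀U⟩ := hK.exists_cthickening_subset_open hU hη.support_subset
  set K₁ := cthickening δ₀ K with hK₁def
  have hK₁ : IsCompact K₁ := hK.cthickening
  have hKK₁ : K ⊆ K₁ := self_subset_cthickening _
  have hvK₁ : ContinuousOn v K₁ := hv.mono hδ₀U
  set v₁ := K₁.indicator v with hv₁def
  have hv₁ : Integrable v₁ :=
    (integrable_indicator_iff hK₁.measurableSet).2 (hvK₁.integrableOn_compact hK₁)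
  obtain ⟨δ₂, hδ₂, hunif⟩ := Metric.uniformContinuousOn_iff.1
    (hK₁.uniformContinuousOn_of_continuous hvK₁) (ε / 2) (by positivity)
  -- The mollifications stay within ε / 2 of v on K, and Φ vanishes up to ε. So all the functions
  -- Φ(f k) η are supported in this one compact subset of D.
  set S := K ∩ v ⁻¹' Ici (ε / 2) with hSdef
  have hSK : S ⊆ K := inter_subset_left
  have hS : IsCompact S := hK.of_isClosed_subset
    ((hvK₁.mono hKK₁).preimage_isClosed_of_isClosed (isClosed_tsupport _) isClosed_Ici) hSK
  have hSD : S ⊆ D := fun x hx =>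
    hvD x (hη.support_subset hx.1) (lt_of_lt_of_le (by positivity) hx.2)
  obtain ⟨δ₁, hδ₁, hδ₁D⟩ := hS.exists_cthickening_subset_open hD hSD
  set K₂ := cthickening δ₁ S with hK₂def
  have hK₂ : IsCompact K₂ := hS.cthickening
  have hSK₂ : S ⊆ K₂ := self_subset_cthickening _
  set G₂ := K₂.indicator G with hG₂def
  have hG₂ : Integrable G₂ := (integrable_indicator_iff hK₂.measurableSet).2
    (hG.2.1.integrableOn_compact_subset hδ₁D hK₂)
  have hG₂p : Integrable fun x => ‖G₂ x‖ ^ p x := by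
    refine ((integrable_indicator_iff hK₂.measurableSet).2 (hGp K₂ hK₂ hδ₁D)).congr
      (Eventually.of_forall fun x => ?_)
    by_cases hx : x ∈ K₂
    · simp [hG₂def, hx]
    · have : p x ≠ 0 := by linarith [hb x]
      simp [hG₂def, hx, this]
  -- the mollifiers
  obtain ⟨φ, hφ0, hφ2, hφδ⟩ :=
    exists_mollifier_seq (n := n) (δ := min (min δ₀ δ₁) (min δ₂ 1)) (by positivity)
  simp only [lt_min_iff] at hφδ
  set f : ℕ → Rn n → ℝ := fun k => mollify (φ k) v₁ with hfdef
  have hfc : ∀ k, ContDiff ℝ ∞ (f k) := fun k => contDiff_mollify _ hv₁.locallyIntegrable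
  have hball₁ : ∀ k, ∀ x ∈ K, closedBall x (φ k).rOut ⊆ K₁ := fun k x hx =>
    (closedBall_subset_closedBall (hφδ k).1.1.le).trans (closedBall_subset_cthickening hx _)
  have hball₂ : ∀ k, ∀ x ∈ S, closedBall x (φ k).rOut ⊆ K₂ := fun k x hx =>
    (closedBall_subset_closedBall (hφδ k).1.2.le).trans (closedBall_subset_cthickening hx _)
  have hfv : ∀ k, ∀ x ∈ K, |f k x - v x| ≤ ε / 2 := by
    intro k x hx
    have hxv : v₁ x = v x := indicator_of_mem (hKK₁ hx) _
    rw [← Real.dist_eq, ← hxv]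
    refine ContDiffBump.dist_normed_convolution_le hv₁.1 fun y hy => ?_
    have hy1 : y ∈ K₁ := hball₁ k x hx (ball_subset_closedBall hy)
    rw [hxv, show v₁ y = v y from indicator_of_mem hy1 _]
    exact (hunif y hy1 x (hKK₁ hx) ((mem_ball.1 hy).trans (hφδ k).2.1)).le
  -- the test functions
  have hsub : ∀ k, tsupport (fun x => Φ (f k x) * η x) ⊆ S := by
    intro k
    refine closure_minimal (fun x hx => ?_) hS.isClosed
    have hx' : Φ (f k x) * η x ≠ 0 := hx
    have hxK : x ∈ K := subset_closure (right_ne_zero_of_mul hx')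
    refine ⟨hxK, ?_⟩
    have h1 : ε < f k x := by
      by_contra hcon
      exact left_ne_zero_of_mul hx' (hΦ0 _ (not_lt.1 hcon))
    have h2 := abs_le.1 (hfv k x hxK)
    show ε / 2 ≤ v x
    linarith
  have htest : ∀ k, IsTestFunction D fun x => Φ (f k x) * η x := fun k =>
    ⟨(hΦ.comp (hfc k)).mul hη.smooth,
      hS.of_isClosed_subset (isClosed_tsupport _) (hsub k), (hsub k).trans hSD⟩
  have hgrad : ∀ k, ∀ x ∈ S, gradient (fun x => Φ (f k x) * η x) x =
      (deriv Φ (f k x) * η x) • mollify (φ k) G₂ x + Φ (f k x) • gradient η x := by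
    intro k x hx
    rw [gradient_comp_mul (hΦ.differentiable (by simp) _) ((hfc k).differentiable (by simp) _)
      (hη.smooth.differentiable (by simp) _),
      gradient_mollify_eq hG (φ k) ((hball₂ k x hx).trans hδ₁D) hv₁
        (fun y hy => indicator_of_mem (hball₁ k x (hSK hx) hy) _)
        (fun y hy => indicator_of_mem (hball₂ k x hx hy) _)]
  have hzero : ∀ k, ∫ x in S, inner ℝ (B x)
      ((deriv Φ (f k x) * η x) • mollify (φ k) G₂ x + Φ (f k x) • gradient η x) = 0 := by
    intro k
    rw [← hB _ (htest k)]
    rw [setIntegral_eq_of_subset_of_forall_sdiff_eq_zero hD.measurableSet hSD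
      (f := fun x => inner ℝ (B x) (gradient (fun x => Φ (f k x) * η x) x))]
    · refine setIntegral_congr_fun hS.measurableSet fun x hx => ?_
      simp only [hgrad k x hx]
    · intro x hx
      rw [gradient_eq_zero_of_notMem_tsupport fun h => hx.2 (hsub k h), inner_zero_right]
  -- uniform bounds
  obtain ⟨V, hV⟩ := hK.exists_bound_of_continuousOn (hvK₁.mono hKK₁)
  obtain ⟨c₁, hc₁⟩ := (isCompact_Icc (a := -(V + ε)) (b := V + ε)).exists_bound_of_continuousOn
    hΦ.continuous.continuousOn
  obtain ⟨c₂, hc₂⟩ := (isCompact_Icc (a := -(V + ε)) (b := V + ε)).exists_bound_of_continuousOn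
    hdΦ.continuousOn
  obtain ⟨c₃, hc₃⟩ := hη.smooth.continuous.bounded_above_of_compact_support hη.compact
  obtain ⟨c₄, hc₄⟩ := hgη.bounded_above_of_compact_support (hasCompactSupport_gradient hη.compact)
  set c := 1 + |c₂| * |c₃| + |c₁| * |c₄| with hcdef
  have hcc1 : 0 ≤ |c₂| * |c₃| := by positivity
  have hcc2 : 0 ≤ |c₁| * |c₄| := by positivity
  have hc1 : 1 ≤ c := by linarith
  have hcoef : ∀ t ∈ Icc (-(V + ε)) (V + ε), ∀ x,
      |deriv Φ t * η x| ≤ c ∧ ‖Φ t • gradient η x‖ ≤ c := by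
    intro t ht x
    have e1 := (hc₁ t ht).trans (le_abs_self _)
    have e2 := (hc₂ t ht).trans (le_abs_self _)
    have e3 := (hc₃ x).trans (le_abs_self _)
    have e4 := (hc₄ x).trans (le_abs_self _)
    rw [Real.norm_eq_abs] at e1 e2 e3
    constructor
    · rw [abs_mul]
      calc _ ≤ |c₂| * |c₃| := by gcongr
        _ ≤ c := by linarith
    · rw [norm_smul, Real.norm_eq_abs]
      calc _ ≤ |c₁| * |c₄| := by gcongr
        _ ≤ c := by linarith
  have hvI : ∀ x ∈ K, v x ∈ Icc (-(V + ε)) (V + ε) := fun x hx => by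
    have := hV x hx
    rw [Real.norm_eq_abs, abs_le] at this
    constructor <;> linarith
  have hfI : ∀ k, ∀ x ∈ K, f k x ∈ Icc (-(V + ε)) (V + ε) := fun k x hx => by
    have h1 := hV x hx
    have h2 := hfv k x hx
    rw [Real.norm_eq_abs, abs_le] at h1
    rw [abs_le] at h2
    constructor <;> linarith
  -- modular bounds
  obtain ⟨C, hC0, hC⟩ := exists_norm_mollify_rpow_le hp hG₂ hG₂p
  have hmc : ∀ k, Continuous (mollify (φ k) G₂) := fun k =>
    (contDiff_mollify _ hG₂.locallyIntegrable).continuous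
  have hbi : ∀ k, IntegrableOn (fun x => ‖mollify (φ k) G₂ x‖ ^ p x) S := fun k =>
    ((hmc k).norm.rpow hpc fun x => Or.inr (by linarith [hb x])).continuousOn.integrableOn_compact hS
  set I := ∫ x, ‖G₂ x‖ ^ p x with hIdef
  have hI0 : 0 ≤ I := integral_nonneg fun x => by positivity
  have hbN : ∀ k, ∫ x in S, ‖mollify (φ k) G₂ x‖ ^ p x ≤ C * (volume.real S + I) := by
    intro k
    have hm : Integrable (mollify (φ k) fun y => ‖G₂ y‖ ^ p y) := integrable_mollify hG₂p
    have h1 : IntegrableOn (fun _ : Rn n => (1 : ℝ)) S := integrableOn_const hS.measure_lt_top.ne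
    calc _ ≤ ∫ x in S, C * (1 + mollify (φ k) (fun y => ‖G₂ y‖ ^ p y) x) :=
          integral_mono (hbi k) ((h1.add hm.integrableOn).const_mul C)
            fun x => hC (φ k) (hφδ k).2.2.le (hφ2 k) x
      _ = C * (volume.real S + ∫ x in S, mollify (φ k) (fun y => ‖G₂ y‖ ^ p y) x) := by
          rw [integral_const_mul, integral_add h1 hm.integrableOn]; simp
      _ ≤ C * (volume.real S + I) := by
          gcongr
          rw [hIdef, ← integral_mollify (φ := φ k) hG₂p]
          exact setIntegral_le_integral hm (Eventually.of_forall
            (mollify_nonneg _ fun x => by positivity))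
  have hBS := hBp S hS hSD
  have hBmS : AEStronglyMeasurable B (volume.restrict S) :=
    hBm.mono_measure (Measure.restrict_mono hSD le_rfl)
  have hfm : ∀ k, AEStronglyMeasurable (fun x => inner ℝ (B x)
      ((deriv Φ (f k x) * η x) • mollify (φ k) G₂ x + Φ (f k x) • gradient η x))
      (volume.restrict S) := fun k => by
    refine hBmS.inner (Continuous.aestronglyMeasurable ?_)
    have := (hfc k).continuous
    have := hη.smooth.continuous
    have := hΦ.continuous
    have := hmc k
    fun_prop
  have hlim : ∀ᵐ x ∂volume.restrict S, Tendsto (fun k => inner ℝ (B x)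
      ((deriv Φ (f k x) * η x) • mollify (φ k) G₂ x + Φ (f k x) • gradient η x)) atTop
      (𝓝 (inner ℝ (B x) ((deriv Φ (v x) * η x) • G x + Φ (v x) • gradient η x))) := by
    have h1 := ContDiffBump.ae_convolution_tendsto_right_of_locallyIntegrable hφ0
      (Eventually.of_forall hφ2) hv₁.locallyIntegrable
    have h2 := ContDiffBump.ae_convolution_tendsto_right_of_locallyIntegrable hφ0
      (Eventually.of_forall hφ2) hG₂.locallyIntegrable
    filter_upwards [ae_restrict_of_ae h1, ae_restrict_of_ae h2, ae_restrict_mem hS.measurableSet]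
      with x e1 e2 hx
    have hxv : v₁ x = v x := indicator_of_mem (hKK₁ (hSK hx)) _
    have hxG : G₂ x = G x := indicator_of_mem (hSK₂ hx) _
    rw [hxv] at e1
    rw [hxG] at e2
    exact tendsto_const_nhds.inner (((((hdΦ.tendsto _).comp e1).mul_const _).smul e2).add
      (((hΦ.continuous.tendsto _).comp e1).smul_const _))
  have hgm := aestronglyMeasurable_of_tendsto_ae atTop hfm hlim
  -- The gradients converge only almost everywhere, with bounded modular. The majorant is C_τ (1 +
  -- ‖B‖^p') plus τ times the modular density.
  obtain ⟨hint, hconv⟩ := tendsto_integral_of_le_add_mul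
    (b := fun k x => ‖mollify (φ k) G₂ x‖ ^ p x) (b' := fun x => ‖G₂ x‖ ^ p x)
    (N := max (C * (volume.real S + I)) I) hfm hgm hbi hG₂p.integrableOn
    (fun k x => by positivity) (fun x => by positivity)
    (fun k => (hbN k).trans (le_max_left _ _))
    ((setIntegral_le_integral hG₂p (Eventually.of_forall fun x => by positivity)).trans
      (le_max_right _ _))
    (by
      intro τ hτ hτ1
      refine ⟨fun x => c * (1 + ‖B x‖ ^ (p x / (p x - 1))) +
        c * (τ / c) ^ (-(1 / (pm - 1))) * ‖B x‖ ^ (p x / (p x - 1)), ?_, fun x => ?_,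
        fun k => ?_, ?_⟩
      · exact (((integrableOn_const hS.measure_lt_top.ne).add hBS).const_mul c).add
          (hBS.const_mul _)
      · positivity
      · filter_upwards [ae_restrict_mem hS.measurableSet] with x hx
        obtain ⟨h1, h2⟩ := hcoef _ (hfI k x (hSK hx)) x
        exact abs_inner_le_conjugate_rpow_add hc1 hτ hτ1 hpm (hb x).1 h1 h2
      · filter_upwards [ae_restrict_mem hS.measurableSet] with x hx
        obtain ⟨h1, h2⟩ := hcoef _ (hvI x (hSK hx)) x
        rw [show G₂ x = G x from indicator_of_mem (hSK₂ hx) _]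
        exact abs_inner_le_conjugate_rpow_add hc1 hτ hτ1 hpm (hb x).1 h1 h2)
    hlim
  simp only [hzero] at hconv
  have hoff : ∀ x ∈ D \ S, inner ℝ (B x)
      ((deriv Φ (v x) * η x) • G x + Φ (v x) • gradient η x) = 0 := by
    intro x hx
    by_cases hxK : x ∈ K
    · have hlt : v x < ε / 2 := by
        by_contra hcon
        exact hx.2 ⟨hxK, not_lt.1 hcon⟩
      have h1 : Φ =ᶠ[𝓝 (v x)] fun _ => 0 := by
        filter_upwards [Iio_mem_nhds hlt] with t ht
        exact hΦ0 t (by linarith [mem_Iio.1 ht])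
      rw [h1.deriv_eq, h1.eq_of_nhds]
      simp
    · rw [image_eq_zero_of_notMem_tsupport hxK, gradient_eq_zero_of_notMem_tsupport hxK]
      simp
  refine ⟨IntegrableOn.of_forall_sdiff_eq_zero hint hD.measurableSet hoff, ?_⟩
  rw [setIntegral_eq_of_subset_of_forall_sdiff_eq_zero hD.measurableSet hSD hoff]
  exact tendsto_nhds_unique hconv tendsto_const_nhds

end Truncation

/-! ### Variable exponent integrability and the flux -/

section Flux

variable {n : ℕ} {p : Rn n → ℝ}

theorem aestronglyMeasurable_norm_rpow {F : Type*} [NormedAddCommGroup F]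
    (hp : IsBoundedLogHolderExponent p) {μ : Measure (Rn n)} {f : Rn n → F}
    (hf : AEStronglyMeasurable f μ) : AEStronglyMeasurable (fun x => ‖f x‖ ^ p x) μ :=
  (hf.norm.aemeasurable.pow hp.continuous.measurable.aemeasurable).aestronglyMeasurable

/-- Since p is bounded, rescaling by c changes the modular by at most the factor (1 + c)^pp, so the
scaling constant can be dropped. -/
theorem memVarLp_iff {F : Type*} [NormedAddCommGroup F] [NormedSpace ℝ F]
    (hp : IsBoundedLogHolderExponent p) {A : Set (Rn n)} {f : Rn n → F} :
    MemVarLp p A f ↔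
      AEStronglyMeasurable f (volume.restrict A) ∧ IntegrableOn (fun x => ‖f x‖ ^ p x) A := by
  obtain ⟨pm, pp, hpm, hb⟩ := hp.bounds
  have key : ∀ g : Rn n → F, AEStronglyMeasurable g (volume.restrict A) →
      (varModular p A g < ⊤ ↔ IntegrableOn (fun x => ‖g x‖ ^ p x) A) := fun g hg => by
    rw [IntegrableOn, Integrable,
      hasFiniteIntegral_iff_ofReal (Eventually.of_forall fun x => by positivity), varModular]
    exact ⟨fun h => ⟨aestronglyMeasurable_norm_rpow hp hg, h⟩, fun h => h.2⟩
  refine and_congr_right fun hf => ⟨fun ⟨c, hc, h⟩ => ?_, fun h => ⟨1, one_pos, ?_⟩⟩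
  · replace h := (key _ (hf.const_smul c⁻¹)).1 h
    refine (h.const_mul ((1 + c) ^ pp)).mono' (aestronglyMeasurable_norm_rpow hp hf)
      (Eventually.of_forall fun x => ?_)
    have h0 : 0 < p x := by linarith [hb x]
    have e : ‖f x‖ = c * ‖c⁻¹ • f x‖ := by
      rw [norm_smul, norm_inv, Real.norm_eq_abs, abs_of_pos hc, mul_inv_cancel_left₀ hc.ne']
    rw [Real.norm_eq_abs, abs_of_nonneg (by positivity)]
    calc ‖f x‖ ^ p x = c ^ p x * ‖c⁻¹ • f x‖ ^ p x := by
          rw [e, Real.mul_rpow hc.le (norm_nonneg _)]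
      _ ≤ (1 + c) ^ pp * ‖c⁻¹ • f x‖ ^ p x := by
          gcongr
          calc c ^ p x ≤ (1 + c) ^ p x := by gcongr; linarith
            _ ≤ (1 + c) ^ pp := Real.rpow_le_rpow_of_exponent_le (by linarith) (hb x).2
  · simp only [inv_one, one_smul]
    exact (key f hf).2 h

theorem norm_pxFlux (G : Rn n → Rn n) {x : Rn n} (hx : 1 < p x) :
    ‖pxFlux p G x‖ = ‖G x‖ ^ (p x - 1) := by
  rw [pxFlux, norm_smul, Real.norm_eq_abs, abs_of_nonneg (by positivity)]
  rcases (norm_nonneg (G x)).eq_or_lt with h | h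
  · rw [← h, mul_zero, Real.zero_rpow (by linarith)]
  · rw [← Real.rpow_add_one h.ne']
    ring_nf

theorem inner_pxFlux_self (G : Rn n → Rn n) {x : Rn n} (hx : 1 < p x) :
    inner ℝ (pxFlux p G x) (G x) = ‖G x‖ ^ p x := by
  rw [pxFlux, real_inner_smul_left, real_inner_self_eq_norm_sq]
  rcases (norm_nonneg (G x)).eq_or_lt with h | h
  · rw [← h, Real.zero_rpow (x := p x) (by linarith)]; simp
  · rw [← Real.rpow_natCast, ← Real.rpow_add h]
    simp

/-- Since (p - 1) · p/(p - 1) = p, the flux is in the conjugate space exactly where the gradient has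
finite energy. -/
theorem norm_pxFlux_conjugate_rpow (G : Rn n → Rn n) {x : Rn n} (hx : 1 < p x) :
    ‖pxFlux p G x‖ ^ (p x / (p x - 1)) = ‖G x‖ ^ p x := by
  rw [norm_pxFlux G hx, ← Real.rpow_mul (norm_nonneg _), mul_div_cancel₀ _ (by linarith)]

theorem norm_pxFlux_le (G : Rn n → Rn n) {x : Rn n} (hx : 1 < p x) :
    ‖pxFlux p G x‖ ≤ 1 + ‖G x‖ ^ p x := by
  rw [← norm_pxFlux_conjugate_rpow G hx]
  exact le_one_add_rpow (norm_nonneg _) (by rw [le_div_iff₀ (by linarith)]; linarith)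

theorem aestronglyMeasurable_pxFlux (hp : IsBoundedLogHolderExponent p) {μ : Measure (Rn n)}
    {G : Rn n → Rn n} (hG : AEStronglyMeasurable G μ) : AEStronglyMeasurable (pxFlux p G) μ :=
  (hG.norm.aemeasurable.pow
    (hp.continuous.sub continuous_const).measurable.aemeasurable).aestronglyMeasurable.smul hG

theorem pxFlux_indicator (G : Rn n → Rn n) (D : Set (Rn n)) :
    pxFlux p (D.indicator G) = D.indicator (pxFlux p G) := by
  ext1 x
  by_cases hx : x ∈ D <;> simp [pxFlux, hx]

end Flux

/-! ### Cutoff functions -/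

theorem exists_isTestFunction_eq_one {n : ℕ} {K U : Set (Rn n)} (hK : IsCompact K)
    (hU : IsOpen U) (hKU : K ⊆ U) :
    ∃ η : Rn n → ℝ, IsTestFunction U η ∧ (∀ x, 0 ≤ η x ∧ η x ≤ 1) ∧ ∀ x ∈ K, η x = 1 := by
  obtain ⟨V, hV, hKV, hVU, hVc⟩ := exists_open_between_and_isCompact_closure hK hU hKU
  obtain ⟨η, hη, h01, hsupp, h1⟩ := exists_contMDiff_support_eq_eq_one_iff
    (modelWithCornersSelf ℝ (Rn n)) (n := ⊤) hV hK.isClosed hKV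
  refine ⟨η, ⟨hη.contDiff, ?_, ?_⟩, fun x => h01 (mem_range_self x), fun x hx => (h1 x).1 hx⟩
  · rwa [HasCompactSupport, tsupport, hsupp]
  · rwa [tsupport, hsupp]

theorem IsTestFunction.mono {n : ℕ} {U V : Set (Rn n)} {φ : Rn n → ℝ} (h : IsTestFunction U φ)
    (hUV : U ⊆ V) : IsTestFunction V φ :=
  ⟨h.smooth, h.compact, h.support_subset.trans hUV⟩

/-- Integration by parts against the constant 1: constant fields are divergence free, hence
admissible in `integral_truncation_eq_zero`. -/
theorem IsTestFunction.integral_inner_gradient_eq_zero {n : ℕ} {U : Set (Rn n)} {φ : Rn n → ℝ}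
    (h : IsTestFunction U φ) (e : Rn n) : ∫ x in U, inner ℝ e (gradient φ x) = 0 := by
  rw [setIntegral_eq_integral_of_forall_compl_eq_zero fun x hx => by
    rw [gradient_eq_zero_of_notMem_tsupport fun h' => hx (h.support_subset h'), inner_zero_right]]
  have hc : Continuous fun x => fderiv ℝ φ x e :=
    (h.smooth.continuous_fderiv (by simp)).clm_apply continuous_const
  have h1 := integral_mul_fderiv_eq_neg_fderiv_mul_of_integrable (μ := (volume : Measure (Rn n)))
    (f := fun _ => (1 : ℝ)) (g := φ) (v := e) (by simp)
    (by simpa using hc.integrable_of_hasCompactSupport (h.compact.fderiv_apply ℝ e))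
    (by simpa using h.smooth.continuous.integrable_of_hasCompactSupport h.compact)
    (fun x _ => differentiableAt_const _) (fun x _ => h.smooth.differentiable (by simp) x)
  simpa [inner_gradient_right] using h1

/-! ### Smooth truncations -/

/-- A smooth nondecreasing step, equal to `0` on `(-∞, ε]` and to `1` on `[2 ε, ∞)`. -/
noncomputable def smoothStep (ε t : ℝ) : ℝ := Real.smoothTransition (t / ε - 1)

/-- A smooth approximation of the positive part. -/
noncomputable def smoothTrunc (ε t : ℝ) : ℝ := t * smoothStep ε t

section Truncations

variable {ε t : ℝ}

theorem contDiff_smoothStep (ε : ℝ) : ContDiff ℝ ∞ (smoothStep ε) :=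
  Real.smoothTransition.contDiff.comp ((contDiff_id.div_const _).sub contDiff_const)

theorem contDiff_smoothTrunc (ε : ℝ) : ContDiff ℝ ∞ (smoothTrunc ε) :=
  contDiff_id.mul (contDiff_smoothStep ε)

theorem smoothStep_nonneg (ε t : ℝ) : 0 ≤ smoothStep ε t := Real.smoothTransition.nonneg _

theorem smoothStep_le_one (ε t : ℝ) : smoothStep ε t ≤ 1 := Real.smoothTransition.le_one _

theorem smoothStep_eq_zero (hε : 0 < ε) (ht : t ≤ ε) : smoothStep ε t = 0 :=
  Real.smoothTransition.zero_of_nonpos (by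
    have : t / ε ≤ 1 := (div_le_one hε).2 ht
    linarith)

theorem smoothStep_eq_one (hε : 0 < ε) (ht : 2 * ε ≤ t) : smoothStep ε t = 1 :=
  Real.smoothTransition.one_of_one_le (by
    have : 2 ≤ t / ε := (le_div_iff₀ hε).2 ht
    linarith)

theorem monotone_smoothStep (hε : 0 < ε) : Monotone (smoothStep ε) := fun _ _ h =>
  Real.smoothTransition.monotone (by gcongr)

theorem deriv_smoothStep_nonneg (hε : 0 < ε) (t : ℝ) : 0 ≤ deriv (smoothStep ε) t :=
  (monotone_smoothStep hε).deriv_nonneg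

theorem smoothTrunc_eq_zero (hε : 0 < ε) (ht : t ≤ ε) : smoothTrunc ε t = 0 := by
  rw [smoothTrunc, smoothStep_eq_zero hε ht, mul_zero]

theorem abs_smoothTrunc_le (ε t : ℝ) : |smoothTrunc ε t| ≤ |t| := by
  rw [smoothTrunc, abs_mul, abs_of_nonneg (smoothStep_nonneg ε t)]
  exact mul_le_of_le_one_right (abs_nonneg t) (smoothStep_le_one ε t)

theorem deriv_smoothTrunc (ε t : ℝ) :
    deriv (smoothTrunc ε) t = smoothStep ε t + t * deriv (smoothStep ε) t := by
  have h := (hasDerivAt_id t).mul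
    ((contDiff_smoothStep ε).differentiable (by simp) t).hasDerivAt
  have h' := h.deriv
  simp only [id, one_mul] at h'
  exact h'

theorem smoothTrunc_nonneg (ht : 0 ≤ t) : 0 ≤ smoothTrunc ε t :=
  mul_nonneg ht (smoothStep_nonneg ε t)

theorem smoothStep_le_deriv_smoothTrunc (hε : 0 < ε) (ht : 0 ≤ t) :
    smoothStep ε t ≤ deriv (smoothTrunc ε) t := by
  rw [deriv_smoothTrunc]
  have := mul_nonneg ht (deriv_smoothStep_nonneg hε t)
  linarith

/-- In the Caccioppoli estimate this gives the cross term the same weight Φ'(v) as the energy term,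
so that it can be absorbed. -/
theorem smoothTrunc_le_mul_deriv (hε : 0 < ε) (ht : 0 ≤ t) :
    smoothTrunc ε t ≤ t * deriv (smoothTrunc ε) t :=
  mul_le_mul_of_nonneg_left (smoothStep_le_deriv_smoothTrunc hε ht) ht

theorem deriv_smoothTrunc_eq (hε : 0 < ε) (t : ℝ) :
    deriv (smoothTrunc ε) t = deriv (smoothTrunc 1) (t / ε) := by
  have h1 : smoothTrunc ε = fun s => ε * smoothTrunc 1 (s / ε) := by
    ext s
    simp only [smoothTrunc, smoothStep, div_one]
    field_simp
  have h2 : HasDerivAt (fun s => ε * smoothTrunc 1 (s / ε))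
      (ε * (deriv (smoothTrunc 1) (t / ε) * (1 / ε))) t :=
    (HasDerivAt.comp (h₂ := smoothTrunc 1) t
      ((contDiff_smoothTrunc 1).differentiable (by simp) (t / ε)).hasDerivAt
      ((hasDerivAt_id t).div_const ε)).const_mul ε
  rw [h1, h2.deriv]
  field_simp

theorem deriv_smoothTrunc_eq_one (hε : 0 < ε) (ht : 2 * ε < t) :
    deriv (smoothTrunc ε) t = 1 := by
  have : smoothTrunc ε =ᶠ[𝓝 t] id := by
    filter_upwards [Ioi_mem_nhds ht] with s hs
    rw [smoothTrunc, smoothStep_eq_one hε (mem_Ioi.1 hs).le, mul_one, id]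
  rw [this.deriv_eq, deriv_id]

/-- By scaling it is enough to take ε = 1. There the derivative is 0 on the negative axis, 1 beyond
2, and continuous on [0, 2]. -/
theorem exists_abs_deriv_smoothTrunc_le :
    ∃ C : ℝ, 0 ≤ C ∧ ∀ ε t : ℝ, 0 < ε → |deriv (smoothTrunc ε) t| ≤ C := by
  have hc : Continuous (deriv (smoothTrunc 1)) :=
    (contDiff_smoothTrunc 1).continuous_deriv (by simp)
  obtain ⟨C, hC⟩ := (isCompact_Icc (a := (0 : ℝ)) (b := 2)).exists_bound_of_continuousOn
    hc.continuousOn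
  refine ⟨max C 1, by positivity, fun ε t hε => ?_⟩
  rw [deriv_smoothTrunc_eq hε]
  set s := t / ε
  rcases lt_or_ge s 0 with h | h
  · have : smoothTrunc 1 =ᶠ[𝓝 s] fun _ => 0 := by
      filter_upwards [Iio_mem_nhds h] with y hy
      exact smoothTrunc_eq_zero one_pos (by linarith [mem_Iio.1 hy])
    rw [this.deriv_eq]
    simp
  rcases le_or_gt s 2 with h' | h'
  · exact (hC s ⟨h, h'⟩).trans (le_max_left _ _)
  · rw [deriv_smoothTrunc_eq_one one_pos (by linarith)]
    simp

theorem eventually_smoothStep_eq_one (ht : 0 < t) :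
    ∀ᶠ k : ℕ in atTop, smoothStep (1 / ((k : ℝ) + 1)) t = 1 ∧
      deriv (smoothTrunc (1 / ((k : ℝ) + 1))) t = 1 := by
  have h := tendsto_one_div_add_atTop_nhds_zero_nat (𝕜 := ℝ)
  filter_upwards [h.eventually_lt_const (half_pos ht)] with k hk
  have hk0 : 0 < 1 / ((k : ℝ) + 1) := by positivity
  exact ⟨smoothStep_eq_one hk0 (by linarith), deriv_smoothTrunc_eq_one hk0 (by linarith)⟩

end Truncations

/-! ### Nonnegative `p(·)`-harmonic functions vanishing continuously on part of the boundary -/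

/-- `v` is continuous on `U`, positive and `p(·)`-harmonic with gradient `G` in the open subset
`D`, and `v = 0` on `U \ D`. -/
structure IsVanishingPxHarmonic {n : ℕ} (p : Rn n → ℝ) (U D : Set (Rn n)) (v : Rn n → ℝ)
    (G : Rn n → Rn n) : Prop where
  exponent : IsBoundedLogHolderExponent p
  isOpen_outer : IsOpen U
  isOpen_inner : IsOpen D
  subset : D ⊆ U
  continuousOn : ContinuousOn v U
  eq_zero : ∀ x ∈ U, x ∉ D → v x = 0
  pos : ∀ x ∈ D, 0 < v x
  sobolev : MemVarSobolevLoc p D v G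
  harmonic : ∀ φ, IsTestFunction D φ → ∫ x in D, inner ℝ (pxFlux p G x) (gradient φ x) = 0

/-- If η g ≥ 2m, the factor m is absorbed into half the energy. Otherwise η g < 2m bounds
everything, because q ≥ s gives η^(q-1) ≤ η^(s-1). The summand 1 makes the base at least 1, so the
exponent s can be raised to b. -/
theorem caccioppoli_aux {g η m s b : ℝ} {q : ℕ} (hη0 : 0 ≤ η) (hη1 : η ≤ 1) (hg : 0 ≤ g)
    (hm : 0 ≤ m) (hs : 1 < s) (hsb : s ≤ b) (hbq : b ≤ q) :
    g ^ (s - 1) * η ^ (q - 1) * m ≤ 1 / 2 * (η ^ q * g ^ s) + (2 * m + 1) ^ b := by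
  have hq : 1 < q := by
    have : (1 : ℝ) < q := by linarith
    exact_mod_cast this
  have hc : 0 ≤ (2 * m + 1) ^ b := by positivity
  rcases hη0.eq_or_lt with rfl | hη
  · rw [zero_pow (by omega), zero_pow (by omega)]; simpa using hc
  rcases le_total (2 * m) (η * g) with h | h
  · have h1 : g ^ (s - 1) * η ^ (q - 1) * m ≤ g ^ (s - 1) * η ^ (q - 1) * (η * g / 2) := by
      gcongr; linarith
    have h2 : g ^ (s - 1) * g = g ^ s := by
      rcases hg.eq_or_lt with rfl | hg
      · rw [mul_zero, Real.zero_rpow (by linarith)]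
      · rw [← Real.rpow_add_one hg.ne']; ring_nf
    have h3 : η ^ (q - 1) * η = η ^ q := by rw [← pow_succ]; congr 1; omega
    calc _ ≤ _ := h1
      _ = 1 / 2 * ((η ^ (q - 1) * η) * (g ^ (s - 1) * g)) := by ring
      _ = 1 / 2 * (η ^ q * g ^ s) := by rw [h2, h3]
      _ ≤ _ := by linarith
  · have h1 : η ^ (q - 1) ≤ η ^ (s - 1) := by
      rw [← Real.rpow_natCast]
      apply Real.rpow_le_rpow_of_exponent_ge hη hη1
      rw [Nat.cast_sub hq.le]
      push_cast
      linarith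
    have h2 : 0 ≤ 1 / 2 * (η ^ q * g ^ s) := by positivity
    calc g ^ (s - 1) * η ^ (q - 1) * m ≤ g ^ (s - 1) * η ^ (s - 1) * m := by gcongr
      _ = (η * g) ^ (s - 1) * m := by rw [Real.mul_rpow hη0 hg]; ring
      _ ≤ (2 * m + 1) ^ (s - 1) * (2 * m + 1) := by gcongr <;> linarith
      _ = (2 * m + 1) ^ s := by rw [← Real.rpow_add_one (by positivity)]; ring_nf
      _ ≤ (2 * m + 1) ^ b := Real.rpow_le_rpow_of_exponent_le (by linarith) hsb
      _ ≤ _ := by linarith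

theorem gradient_pow {n : ℕ} {η : Rn n → ℝ} {x : Rn n} (hη : DifferentiableAt ℝ η x) (q : ℕ) :
    gradient (fun y => η y ^ q) x = ((q : ℝ) * η x ^ (q - 1)) • gradient η x := by
  rw [gradient, fderiv_fun_pow _ hη, gradient, ← map_smul]
  simp

theorem IsTestFunction.pow {n : ℕ} {U : Set (Rn n)} {η : Rn n → ℝ} (hη : IsTestFunction U η)
    {q : ℕ} (hq : q ≠ 0) : IsTestFunction U fun x => η x ^ q := by
  have hsub : tsupport (fun x => η x ^ q) ⊆ tsupport η :=
    closure_mono fun x hx => by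
      have : η x ^ q ≠ 0 := hx
      exact fun h => this (by rw [h, zero_pow hq])
  exact ⟨hη.smooth.pow q, hη.compact.of_isClosed_subset (isClosed_tsupport _) hsub,
    hsub.trans hη.support_subset⟩

namespace IsVanishingPxHarmonic

variable {n : ℕ} {p : Rn n → ℝ} {U D : Set (Rn n)} {v : Rn n → ℝ} {G : Rn n → Rn n}

theorem aestronglyMeasurable_gradient (h : IsVanishingPxHarmonic p U D v G) :
    AEStronglyMeasurable G (volume.restrict D) :=
  h.sobolev.1.2.1.aestronglyMeasurable

theorem one_lt (h : IsVanishingPxHarmonic p U D v G) (x : Rn n) : 1 < p x := by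
  obtain ⟨pm, pp, hpm, hb⟩ := h.exponent.bounds
  linarith [hb x]

theorem mem_of_pos (h : IsVanishingPxHarmonic p U D v G) {x : Rn n} (hx : x ∈ U) (hv : 0 < v x) :
    x ∈ D := by
  by_contra hxD
  exact hv.ne' (h.eq_zero x hx hxD)

theorem integrableOn_rpow_of_subset (h : IsVanishingPxHarmonic p U D v G) {K : Set (Rn n)}
    (hK : IsCompact K) (hKD : K ⊆ D) : IntegrableOn (fun x => ‖G x‖ ^ p x) K :=
  ((memVarLp_iff h.exponent).1 (h.sobolev.2 K hK hKD).2).2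

/-- The equation tested with a truncation of the solution. -/
theorem integral_flux_truncation (h : IsVanishingPxHarmonic p U D v G) {Φ : ℝ → ℝ}
    (hΦ : ContDiff ℝ ∞ Φ) {ε : ℝ} (hε : 0 < ε) (hΦ0 : ∀ t ≤ ε, Φ t = 0)
    {η : Rn n → ℝ} (hη : IsTestFunction U η) :
    IntegrableOn (fun x => inner ℝ (pxFlux p G x)
      ((deriv Φ (v x) * η x) • G x + Φ (v x) • gradient η x)) D ∧
    ∫ x in D, inner ℝ (pxFlux p G x)
      ((deriv Φ (v x) * η x) • G x + Φ (v x) • gradient η x) = 0 := by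
  refine integral_truncation_eq_zero h.exponent h.isOpen_outer h.isOpen_inner h.continuousOn
    (fun x hx => h.mem_of_pos hx) h.sobolev.1 (fun K => h.integrableOn_rpow_of_subset)
    (aestronglyMeasurable_pxFlux h.exponent h.aestronglyMeasurable_gradient) (fun K hK hKD => ?_)
    h.harmonic hΦ hε hΦ0 hη
  simp only [norm_pxFlux_conjugate_rpow G (h.one_lt _)]
  exact h.integrableOn_rpow_of_subset hK hKD

/-- The gradient with its weak derivative property tested with a truncation. -/
theorem integral_const_truncation (h : IsVanishingPxHarmonic p U D v G) (e : Rn n) {Φ : ℝ → ℝ}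
    (hΦ : ContDiff ℝ ∞ Φ) {ε : ℝ} (hε : 0 < ε) (hΦ0 : ∀ t ≤ ε, Φ t = 0)
    {η : Rn n → ℝ} (hη : IsTestFunction U η) :
    IntegrableOn (fun x => inner ℝ e
      ((deriv Φ (v x) * η x) • G x + Φ (v x) • gradient η x)) D ∧
    ∫ x in D, inner ℝ e ((deriv Φ (v x) * η x) • G x + Φ (v x) • gradient η x) = 0 := by
  refine integral_truncation_eq_zero (B := fun _ => e) h.exponent h.isOpen_outer h.isOpen_inner
    h.continuousOn (fun x hx => h.mem_of_pos hx) h.sobolev.1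
    (fun K => h.integrableOn_rpow_of_subset) aestronglyMeasurable_const (fun K hK hKD => ?_)
    (fun φ hφ => hφ.integral_inner_gradient_eq_zero e) hΦ hε hΦ0 hη
  have hc := h.exponent.continuous
  have h1 : ∀ x, p x - 1 ≠ 0 := fun x => by linarith [h.one_lt x]
  refine (Continuous.rpow continuous_const (hc.div (hc.sub continuous_const) h1)
    fun x => Or.inr ?_).continuousOn.integrableOn_compact hK
  exact div_pos (by linarith [h.one_lt x]) (sub_pos.2 (h.one_lt x))

/-- Caccioppoli estimate: the gradient has finite energy up to the boundary. -/
theorem integrableOn_rpow (h : IsVanishingPxHarmonic p U D v G) {K : Set (Rn n)}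
    (hK : IsCompact K) (hKU : K ⊆ U) : IntegrableOn (fun x => ‖G x‖ ^ p x) (K ∩ D) := by
  obtain ⟨pm, pp, hpm, hb⟩ := h.exponent.bounds
  obtain ⟨η, hη, hη01, hη1⟩ := exists_isTestFunction_eq_one hK h.isOpen_outer hKU
  set L := tsupport η with hLdef
  have hL : IsCompact L := hη.compact
  have hKL : K ⊆ L := fun x hx => subset_closure (by
    rw [Function.mem_support, hη1 x hx]; exact one_ne_zero)
  obtain ⟨N, hN⟩ := (continuous_gradient_of_contDiff hη.smooth).bounded_above_of_compact_support
    (hasCompactSupport_gradient hη.compact)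
  have hN0 : 0 ≤ N := (norm_nonneg _).trans (hN 0)
  obtain ⟨V, hV⟩ := hL.exists_bound_of_continuousOn (h.continuousOn.mono hη.support_subset)
  obtain ⟨Cd, hCd0, hCd⟩ := exists_abs_deriv_smoothTrunc_le
  -- The cutoff is raised to a power at least the upper bound of p, as `caccioppoli_aux` needs at
  -- every point.
  set q := ⌈pp⌉₊ with hq
  have hpq : pp ≤ q := Nat.le_ceil pp
  have hq0 : q ≠ 0 := by
    rintro h0
    rw [h0] at hpq
    have := hb 0
    norm_num at hpq
    linarith
  -- This bounds v |∇(η^q)| / η^(q-1), the factor left in the cross term.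
  set m := q * |V| * N with hm
  have hm0 : 0 ≤ m := by positivity
  set c := (2 * m + 1) ^ pp with hc
  have hc0 : 0 ≤ c := by positivity
  -- On T k the smooth step at level 1/(k+1) equals 1, so Φ'(v) ≥ 1 there. These compact sets
  -- exhaust K ∩ D, and a bound uniform in k gives integrability.
  set T : ℕ → Set (Rn n) := fun k => K ∩ v ⁻¹' Ici (2 * (1 / ((k : ℝ) + 1))) with hT
  have hεk : ∀ k : ℕ, 0 < 1 / ((k : ℝ) + 1) := fun k => by positivity
  have hTc : ∀ k, IsCompact (T k) := fun k => hK.of_isClosed_subset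
    ((h.continuousOn.mono hKU).preimage_isClosed_of_isClosed hK.isClosed isClosed_Ici)
    inter_subset_left
  have hTD : ∀ k, T k ⊆ D := fun k x hx => h.mem_of_pos (hKU hx.1) (by
    have h1 : 2 * (1 / ((k : ℝ) + 1)) ≤ v x := hx.2
    linarith [hεk k])
  have hbound : ∀ k, ∫ x in T k, ‖G x‖ ^ p x ≤ 2 * (c * Cd * volume.real L) := by
    intro k
    set ε := 1 / ((k : ℝ) + 1) with hε
    obtain ⟨hf, hf0⟩ := h.integral_flux_truncation (contDiff_smoothTrunc ε) (hεk k)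
      (fun t ht => smoothTrunc_eq_zero (hεk k) ht) (hη.pow hq0)
    set f := fun x => inner ℝ (pxFlux p G x)
      ((deriv (smoothTrunc ε) (v x) * η x ^ q) • G x +
        smoothTrunc ε (v x) • gradient (fun y => η y ^ q) x) with hfdef
    have hL1 : Integrable (L.indicator fun _ => c * Cd) :=
      (integrable_indicator_iff hL.measurableSet).2 (integrableOn_const hL.measure_lt_top.ne)
    -- Since f has integral zero over D, this pointwise bound leaves only the constant term on L,
    -- which does not depend on k.
    have hpt : ∀ x ∈ D, (T k).indicator (fun x => ‖G x‖ ^ p x) x ≤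
        2 * (f x + L.indicator (fun _ => c * Cd) x) := by
      intro x hxD
      have hv0 := h.pos x hxD
      have hd0 : smoothStep ε (v x) ≤ deriv (smoothTrunc ε) (v x) :=
        smoothStep_le_deriv_smoothTrunc (hεk k) hv0.le
      have hd : 0 ≤ deriv (smoothTrunc ε) (v x) := (smoothStep_nonneg _ _).trans hd0
      have hdC : deriv (smoothTrunc ε) (v x) ≤ Cd := (le_abs_self _).trans (hCd ε _ (hεk k))
      have hfx : f x = deriv (smoothTrunc ε) (v x) * (η x ^ q * ‖G x‖ ^ p x) +
          smoothTrunc ε (v x) * (q * η x ^ (q - 1)) *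
            inner ℝ (pxFlux p G x) (gradient η x) := by
        rw [hfdef]
        simp only [inner_add_right, real_inner_smul_right, inner_pxFlux_self G (h.one_lt x),
          gradient_pow (hη.smooth.differentiable (by simp) x)]
        ring
      by_cases hxL : x ∈ L
      · have hVx : v x ≤ |V| := (le_abs_self _).trans ((hV x hxL).trans (le_abs_self V))
        have h1 : |smoothTrunc ε (v x) * (q * η x ^ (q - 1)) *
            inner ℝ (pxFlux p G x) (gradient η x)| ≤
            deriv (smoothTrunc ε) (v x) * (‖G x‖ ^ (p x - 1) * η x ^ (q - 1) * m) := by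
          have hη0 := (hη01 x).1
          have hi : |inner ℝ (pxFlux p G x) (gradient η x)| ≤ ‖G x‖ ^ (p x - 1) * N := by
            rw [← norm_pxFlux G (h.one_lt x)]
            exact (abs_real_inner_le_norm _ _).trans (by gcongr; exact hN x)
          rw [abs_mul, abs_of_nonneg (mul_nonneg (smoothTrunc_nonneg hv0.le) (by positivity))]
          calc _ ≤ (|V| * deriv (smoothTrunc ε) (v x)) * (q * η x ^ (q - 1)) *
                (‖G x‖ ^ (p x - 1) * N) := by
                gcongr
                exact (smoothTrunc_le_mul_deriv (hεk k) hv0.le).trans (by gcongr)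
            _ = _ := by rw [hm]; ring
        have h2 := caccioppoli_aux (hη01 x).1 (hη01 x).2 (norm_nonneg (G x)) hm0 (h.one_lt x)
          (hb x).2 hpq
        have h3 : deriv (smoothTrunc ε) (v x) * (1 / 2 * (η x ^ q * ‖G x‖ ^ p x)) ≤
            f x + c * Cd := by
          have h4 := (abs_le.1 (h1.trans (mul_le_mul_of_nonneg_left h2 hd))).1
          have h5 : deriv (smoothTrunc ε) (v x) * c ≤ c * Cd := by
            rw [mul_comm]; gcongr
          rw [hfx]
          rw [mul_add] at h4
          linarith
        rw [indicator_of_mem hxL]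
        by_cases hxT : x ∈ T k
        · rw [indicator_of_mem hxT]
          rw [hη1 x hxT.1, one_pow, one_mul] at h3
          rw [smoothStep_eq_one (hεk k) hxT.2] at hd0
          have h6 : 0 ≤ ‖G x‖ ^ p x := by positivity
          have h7 : 1 * (1 / 2 * ‖G x‖ ^ p x) ≤
            deriv (smoothTrunc ε) (v x) * (1 / 2 * ‖G x‖ ^ p x) := by gcongr
          linarith
        · rw [indicator_of_notMem hxT]
          have h6 : 0 ≤ deriv (smoothTrunc ε) (v x) * (1 / 2 * (η x ^ q * ‖G x‖ ^ p x)) := by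
            have := (hη01 x).1
            positivity
          linarith
      · rw [indicator_of_notMem fun hxT => hxL (hKL hxT.1), indicator_of_notMem hxL, hfx,
          gradient_eq_zero_of_notMem_tsupport hxL, inner_zero_right]
        have := (hη01 x).1
        have h6 : 0 ≤ deriv (smoothTrunc ε) (v x) * (η x ^ q * ‖G x‖ ^ p x) := by positivity
        linarith
    have hTi : IntegrableOn ((T k).indicator fun x => ‖G x‖ ^ p x) D :=
      ((integrable_indicator_iff (hTc k).measurableSet).2
        (h.integrableOn_rpow_of_subset (hTc k) (hTD k))).integrableOn
    calc ∫ x in T k, ‖G x‖ ^ p x = ∫ x in D, (T k).indicator (fun x => ‖G x‖ ^ p x) x := by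
          rw [setIntegral_indicator (hTc k).measurableSet, inter_eq_self_of_subset_right (hTD k)]
      _ ≤ ∫ x in D, 2 * (f x + L.indicator (fun _ => c * Cd) x) :=
          setIntegral_mono_on hTi ((hf.add hL1.integrableOn).const_mul 2)
            h.isOpen_inner.measurableSet hpt
      _ = 2 * ∫ x in D, L.indicator (fun _ => c * Cd) x := by
          rw [integral_const_mul, integral_add hf hL1.integrableOn, hf0, zero_add]
      _ ≤ 2 * (c * Cd * volume.real L) := by
          gcongr
          refine (setIntegral_le_integral hL1 (Eventually.of_forall fun x =>
            indicator_nonneg (fun _ _ => by positivity) x)).trans (le_of_eq ?_)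
          rw [integral_indicator hL.measurableSet, setIntegral_const, smul_eq_mul, mul_comm]
  have hcover : AECover (volume.restrict (K ∩ D)) atTop T := by
    refine ⟨?_, fun k => (hTc k).measurableSet⟩
    filter_upwards [ae_restrict_mem (hK.measurableSet.inter h.isOpen_inner.measurableSet)]
      with x hx
    have h1 := tendsto_one_div_add_atTop_nhds_zero_nat (𝕜 := ℝ)
    filter_upwards [h1.eventually_lt_const (half_pos (h.pos x hx.2))] with k hk
    refine ⟨hx.1, ?_⟩
    show 2 * (1 / ((k : ℝ) + 1)) ≤ v x
    linarith
  have hres : ∀ k, (volume.restrict (K ∩ D)).restrict (T k) = volume.restrict (T k) := fun k => by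
    rw [Measure.restrict_restrict (hTc k).measurableSet,
      inter_eq_self_of_subset_left (subset_inter inter_subset_left (hTD k))]
  refine hcover.integrable_of_integral_norm_bounded (2 * (c * Cd * volume.real L)) (fun k => ?_)
    (Eventually.of_forall fun k => ?_)
  · rw [IntegrableOn, hres]
    exact h.integrableOn_rpow_of_subset (hTc k) (hTD k)
  · rw [hres]
    refine le_trans (le_of_eq ?_) (hbound k)
    congr 1; ext x
    rw [Real.norm_eq_abs, abs_of_nonneg (by positivity)]

theorem integrableOn_gradient (h : IsVanishingPxHarmonic p U D v G) {K : Set (Rn n)}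
    (hK : IsCompact K) (hKU : K ⊆ U) : IntegrableOn G (K ∩ D) := by
  have h1 : IntegrableOn (fun _ : Rn n => (1 : ℝ)) (K ∩ D) :=
    integrableOn_const ((measure_mono inter_subset_left).trans_lt hK.measure_lt_top).ne
  refine (h1.add (h.integrableOn_rpow hK hKU)).mono' (h.aestronglyMeasurable_gradient.mono_measure
    (Measure.restrict_mono inter_subset_right le_rfl)) (Eventually.of_forall fun x => ?_)
  exact le_one_add_rpow (norm_nonneg _) (h.one_lt x).le

theorem integrableOn_inner_flux (h : IsVanishingPxHarmonic p U D v G) {ψ : Rn n → ℝ}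
    (hψ : IsTestFunction U ψ) :
    IntegrableOn (fun x => inner ℝ (pxFlux p G x) (gradient ψ x)) D := by
  have hgc := continuous_gradient_of_contDiff hψ.smooth
  obtain ⟨N, hN⟩ := hgc.bounded_above_of_compact_support (hasCompactSupport_gradient hψ.compact)
  have h1 : IntegrableOn (fun _ : Rn n => (1 : ℝ)) (tsupport ψ ∩ D) := integrableOn_const
    ((measure_mono inter_subset_left).trans_lt hψ.compact.measure_lt_top).ne
  have hm : AEStronglyMeasurable (pxFlux p G) (volume.restrict (tsupport ψ ∩ D)) :=
    (aestronglyMeasurable_pxFlux h.exponent h.aestronglyMeasurable_gradient).mono_measure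
      (Measure.restrict_mono inter_subset_right le_rfl)
  refine IntegrableOn.of_forall_sdiff_eq_zero (s := tsupport ψ ∩ D)
    (((h1.add (h.integrableOn_rpow hψ.compact hψ.support_subset)).mul_const N).mono'
      (hm.inner hgc.aestronglyMeasurable) (Eventually.of_forall fun x => ?_))
    h.isOpen_inner.measurableSet fun x hx => ?_
  · refine (norm_inner_le_norm _ _).trans ?_
    exact mul_le_mul (norm_pxFlux_le G (h.one_lt x)) (hN x) (norm_nonneg _)
      (add_nonneg zero_le_one (by positivity))
  · rw [gradient_eq_zero_of_notMem_tsupport fun h' => hx.2 ⟨h', hx.1⟩, inner_zero_right]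

end IsVanishingPxHarmonic

/-! ### Weak gradient and subsolution property across the boundary -/

namespace IsVanishingPxHarmonic

variable {n : ℕ} {p : Rn n → ℝ} {U D : Set (Rn n)} {v : Rn n → ℝ} {G : Rn n → Rn n}

theorem integrableOn_smul_gradient (h : IsVanishingPxHarmonic p U D v G) {φ : Rn n → ℝ}
    (hφ : IsTestFunction U φ) : IntegrableOn (fun x => φ x • G x) D := by
  obtain ⟨c, hc⟩ := hφ.smooth.continuous.bounded_above_of_compact_support hφ.compact
  refine IntegrableOn.of_forall_sdiff_eq_zero (s := tsupport φ ∩ D)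
    ((h.integrableOn_gradient hφ.compact hφ.support_subset).bdd_smul (C := c)
      hφ.smooth.continuous.aestronglyMeasurable (Eventually.of_forall hc))
    h.isOpen_inner.measurableSet fun x hx => ?_
  rw [image_eq_zero_of_notMem_tsupport fun h' => hx.2 ⟨h', hx.1⟩, zero_smul]

theorem integrable_smul_gradient_test (h : IsVanishingPxHarmonic p U D v G) {φ : Rn n → ℝ}
    (hφ : IsTestFunction U φ) : Integrable fun x => v x • gradient φ x := by
  have hc : ContinuousOn (fun x => v x • gradient φ x) (tsupport φ) :=
    (h.continuousOn.mono hφ.support_subset).smul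
      (continuous_gradient_of_contDiff hφ.smooth).continuousOn
  refine (integrableOn_iff_integrable_of_support_subset fun x hx => ?_).1
    (hc.integrableOn_compact hφ.compact)
  by_contra h'
  exact hx (by simp only [gradient_eq_zero_of_notMem_tsupport h', smul_zero])

/-- Test constant fields with truncations. Φ' is bounded uniformly in ε and |Φ(t)| ≤ |t|, so
dominated convergence applies; at each point of D, where v > 0, the truncation is eventually the
identity. No boundary term survives. -/
theorem integral_smul_gradient_add (h : IsVanishingPxHarmonic p U D v G) {φ : Rn n → ℝ}
    (hφ : IsTestFunction U φ) : ∫ x in D, (φ x • G x + v x • gradient φ x) = 0 := by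
  obtain ⟨Cd, hCd0, hCd⟩ := exists_abs_deriv_smoothTrunc_le
  have hi1 := h.integrableOn_smul_gradient hφ
  have hi2 := (h.integrable_smul_gradient_test hφ).integrableOn (s := D)
  refine ext_inner_left ℝ fun e => ?_
  refine (integral_inner (hi1.add hi2) e).symm.trans ?_
  rw [inner_zero_right]
  have key := fun k : ℕ => h.integral_const_truncation e
    (contDiff_smoothTrunc (1 / ((k : ℝ) + 1))) (by positivity : 0 < 1 / ((k : ℝ) + 1))
    (fun t ht => smoothTrunc_eq_zero (by positivity) ht) hφ
  have hlim : Tendsto (fun k : ℕ => ∫ x in D, inner ℝ e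
      ((deriv (smoothTrunc (1 / ((k : ℝ) + 1))) (v x) * φ x) • G x +
        smoothTrunc (1 / ((k : ℝ) + 1)) (v x) • gradient φ x)) atTop
      (𝓝 (∫ x in D, inner ℝ e (φ x • G x + v x • gradient φ x))) := by
    refine tendsto_integral_of_dominated_convergence
      (fun x => ‖e‖ * (Cd * ‖φ x • G x‖ + ‖v x • gradient φ x‖)) (fun k => (key k).1.1)
      (((hi1.norm.const_mul Cd).add hi2.norm).const_mul ‖e‖) (fun k => ?_) ?_
    · refine Eventually.of_forall fun x => (norm_inner_le_norm _ _).trans ?_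
      gcongr
      refine (norm_add_le _ _).trans (add_le_add ?_ ?_)
      · rw [mul_smul, norm_smul, Real.norm_eq_abs]
        gcongr
        exact hCd _ _ (by positivity)
      · rw [norm_smul, norm_smul, Real.norm_eq_abs, Real.norm_eq_abs]
        exact mul_le_mul_of_nonneg_right (abs_smoothTrunc_le _ _) (norm_nonneg _)
    · filter_upwards [ae_restrict_mem h.isOpen_inner.measurableSet] with x hx
      refine tendsto_const_nhds.congr' ?_
      filter_upwards [eventually_smoothStep_eq_one (h.pos x hx)] with k hk
      rw [hk.2, smoothTrunc, hk.1, one_mul, mul_one]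
  simp only [(key _).2] at hlim
  exact tendsto_nhds_unique hlim tendsto_const_nhds

/-- The extension by zero of the gradient is the weak gradient across the boundary. -/
theorem memVarSobolevLoc (h : IsVanishingPxHarmonic p U D v G) :
    MemVarSobolevLoc p U v (D.indicator G) := by
  have hGm : AEStronglyMeasurable (D.indicator G) volume :=
    (aestronglyMeasurable_indicator_iff h.isOpen_inner.measurableSet).2
      h.aestronglyMeasurable_gradient
  have hDm := h.isOpen_inner.measurableSet
  refine ⟨⟨h.continuousOn.locallyIntegrableOn h.isOpen_outer.measurableSet, ?_, fun φ hφ => ?_⟩,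
    fun K hK hKU => ⟨(memVarLp_iff h.exponent).2 ?_, (memVarLp_iff h.exponent).2 ⟨hGm.restrict, ?_⟩⟩⟩
  · rw [locallyIntegrableOn_iff h.isOpen_outer.isLocallyClosed]
    intro K hKU hK
    rw [integrableOn_indicator_iff hDm, inter_comm]
    exact h.integrableOn_gradient hK hKU
  · have h1 := h.integral_smul_gradient_add hφ
    rw [integral_add (h.integrableOn_smul_gradient hφ)
      (h.integrable_smul_gradient_test hφ).integrableOn] at h1
    rw [setIntegral_eq_of_subset_of_forall_sdiff_eq_zero h.isOpen_outer.measurableSet h.subset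
      fun x hx => by rw [h.eq_zero x hx.1 hx.2, zero_smul]]
    rw [eq_neg_iff_add_eq_zero, add_comm, ← h1]
    congr 1
    rw [setIntegral_eq_of_subset_of_forall_sdiff_eq_zero h.isOpen_outer.measurableSet h.subset
      fun x hx => by rw [indicator_of_notMem hx.2, smul_zero]]
    exact setIntegral_congr_fun hDm fun x hx => by simp only [indicator_of_mem hx]
  · have hvK := h.continuousOn.mono hKU
    refine ⟨hvK.aestronglyMeasurable hK.measurableSet, ContinuousOn.integrableOn_compact hK ?_⟩
    exact hvK.norm.rpow h.exponent.continuous.continuousOn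
      fun x _ => Or.inr (by linarith [h.one_lt x])
  · have : (fun x => ‖D.indicator G x‖ ^ p x) = D.indicator fun x => ‖G x‖ ^ p x := by
      ext x
      have : p x ≠ 0 := by linarith [h.one_lt x]
      by_cases hx : x ∈ D <;> simp [hx, this]
    rw [this, integrableOn_indicator_iff hDm, inter_comm]
    exact h.integrableOn_rpow hK hKU

/-- The extension by zero is a subsolution. -/
theorem integral_inner_flux_nonpos (h : IsVanishingPxHarmonic p U D v G) {ψ : Rn n → ℝ}
    (hψ : IsTestFunction U ψ) (hψ0 : ∀ x, 0 ≤ ψ x) :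
    ∫ x in D, inner ℝ (pxFlux p G x) (gradient ψ x) ≤ 0 := by
  have hi := h.integrableOn_inner_flux hψ
  have hvm : AEStronglyMeasurable v (volume.restrict D) :=
    (h.continuousOn.mono h.subset).aestronglyMeasurable h.isOpen_inner.measurableSet
  have hm : ∀ k : ℕ, AEStronglyMeasurable (fun x => smoothStep (1 / ((k : ℝ) + 1)) (v x) *
      inner ℝ (pxFlux p G x) (gradient ψ x)) (volume.restrict D) := fun k =>
    ((contDiff_smoothStep _).continuous.comp_aestronglyMeasurable hvm).mul hi.1
  have hle : ∀ (k : ℕ) x, ‖smoothStep (1 / ((k : ℝ) + 1)) (v x) *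
      inner ℝ (pxFlux p G x) (gradient ψ x)‖ ≤ ‖inner ℝ (pxFlux p G x) (gradient ψ x)‖ := by
    intro k x
    rw [norm_mul, Real.norm_eq_abs, abs_of_nonneg (smoothStep_nonneg _ _)]
    exact mul_le_of_le_one_left (norm_nonneg _) (smoothStep_le_one _ _)
  have hlim : Tendsto (fun k : ℕ => ∫ x in D, smoothStep (1 / ((k : ℝ) + 1)) (v x) *
      inner ℝ (pxFlux p G x) (gradient ψ x)) atTop
      (𝓝 (∫ x in D, inner ℝ (pxFlux p G x) (gradient ψ x))) := by
    refine tendsto_integral_of_dominated_convergence _ hm hi.norm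
      (fun k => Eventually.of_forall (hle k)) ?_
    filter_upwards [ae_restrict_mem h.isOpen_inner.measurableSet] with x hx
    refine tendsto_const_nhds.congr' ?_
    filter_upwards [eventually_smoothStep_eq_one (h.pos x hx)] with k hk
    rw [hk.1, one_mul]
  refine le_of_tendsto hlim (Eventually.of_forall fun k => ?_)
  have hk0 : 0 < 1 / ((k : ℝ) + 1) := by positivity
  obtain ⟨h1, h2⟩ := h.integral_flux_truncation (contDiff_smoothStep (1 / ((k : ℝ) + 1))) hk0
    (fun t ht => smoothStep_eq_zero hk0 ht) hψ
  rw [← h2]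
  -- The tested identity differs from the left side by Φ'(v) ψ |G|^p, which is nonnegative because
  -- the step is nondecreasing.
  refine integral_mono (hi.norm.mono' (hm k) (Eventually.of_forall (hle k))) h1 fun x => ?_
  simp only [inner_add_right, real_inner_smul_right, inner_pxFlux_self G (h.one_lt x)]
  have h3 := deriv_smoothStep_nonneg hk0 (v x)
  have h4 := hψ0 x
  have h5 : 0 ≤ deriv (smoothStep (1 / ((k : ℝ) + 1))) (v x) * ψ x * ‖G x‖ ^ p x := by positivity
  linarith

end IsVanishingPxHarmonic

/-! ### Positive functionals on smooth functions are measures -/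

section Representation

open CompactlySupported

variable {n : ℕ}

theorem IsTestFunction.integrable {U : Set (Rn n)} {φ : Rn n → ℝ} (hφ : IsTestFunction U φ)
    (μ : Measure (Rn n)) [IsFiniteMeasureOnCompacts μ] : Integrable φ μ :=
  hφ.smooth.continuous.integrable_of_hasCompactSupport hφ.compact

theorem IsTestFunction.mul_smooth {U : Set (Rn n)} {χ f : Rn n → ℝ} (hχ : IsTestFunction U χ)
    (hf : ContDiff ℝ ∞ f) : IsTestFunction U fun x => χ x * f x :=
  ⟨hχ.smooth.mul hf, hχ.compact.mul_right, (tsupport_mul_subset_left).trans hχ.support_subset⟩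

/-- A positive linear functional on test functions, multiplied by a cutoff function, is given by a
locally finite measure. -/
theorem exists_measure_of_nonneg {U : Set (Rn n)} (T : (Rn n → ℝ) → ℝ)
    (hadd : ∀ φ ψ, IsTestFunction U φ → IsTestFunction U ψ →
      T (fun x => φ x + ψ x) = T φ + T ψ)
    (hsmul : ∀ (c : ℝ) φ, IsTestFunction U φ → T (fun x => c * φ x) = c * T φ)
    (hpos : ∀ φ, IsTestFunction U φ → (∀ x, 0 ≤ φ x) → 0 ≤ T φ)
    {χ : Rn n → ℝ} (hχ : IsTestFunction U χ) (hχ0 : ∀ x, 0 ≤ χ x) :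
    ∃ μ : Measure (Rn n), IsFiniteMeasureOnCompacts μ ∧
      ∀ f : Rn n → ℝ, ContDiff ℝ ∞ f → HasCompactSupport f →
        ∫ x, f x ∂μ = T fun x => χ x * f x := by
  let S : Submodule ℝ C_c(Rn n, ℝ) :=
    { carrier := {f | ContDiff ℝ ∞ f}
      add_mem' := fun {f g} hf hg => show ContDiff ℝ ∞ fun x => f x + g x from
        ContDiff.add (show ContDiff ℝ ∞ f from hf) (show ContDiff ℝ ∞ g from hg)
      zero_mem' := show ContDiff ℝ ∞ fun _ => (0 : ℝ) from contDiff_const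
      smul_mem' := fun c f hf => show ContDiff ℝ ∞ fun x => c * f x from
        contDiff_const.mul (show ContDiff ℝ ∞ f from hf) }
  let P : PointedCone ℝ C_c(Rn n, ℝ) :=
    { carrier := {f | ∀ x, 0 ≤ f x}
      add_mem' := fun hf hg x => add_nonneg (hf x) (hg x)
      zero_mem' := fun _ => le_rfl
      smul_mem' := fun c _ hf x => mul_nonneg c.2 (hf x) }
  let F : C_c(Rn n, ℝ) →ₗ.[ℝ] ℝ :=
    { domain := S
      toFun :=
        { toFun := fun f => T fun x => χ x * f.1 x
          map_add' := fun f g => by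
            rw [← hadd _ _ (hχ.mul_smooth f.2) (hχ.mul_smooth g.2)]
            congr 1; ext x
            simp [mul_add]
          map_smul' := fun c f => by
            rw [RingHom.id_apply, smul_eq_mul, ← hsmul c _ (hχ.mul_smooth f.2)]
            congr 1; ext x
            simp; ring } }
  -- Positivity lets the functional extend from smooth functions to all of C_c without a density
  -- argument. The domination hypothesis holds because y + cη ≥ 0 when η = 1 on supp y and c bounds
  -- |y|.
  obtain ⟨g, hg, hg0⟩ := riesz_extension P F
    (fun f hf => hpos _ (hχ.mul_smooth f.2) fun x => mul_nonneg (hχ0 x) (hf x))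
    (fun y => by
      obtain ⟨η, hη, hη01, hη1⟩ := exists_isTestFunction_eq_one
        (K := tsupport y) y.hasCompactSupport isOpen_univ (subset_univ _)
      obtain ⟨c, hc⟩ := y.continuous.bounded_above_of_compact_support y.hasCompactSupport
      have hc0 : 0 ≤ c := (norm_nonneg _).trans (hc 0)
      have hs : ContDiff ℝ ∞ fun x => c * η x := contDiff_const.mul hη.smooth
      refine ⟨⟨⟨⟨fun x => c * η x, hs.continuous⟩, hη.compact.mul_left⟩, hs⟩, fun x => ?_⟩
      show 0 ≤ c * η x + y x
      by_cases hx : x ∈ tsupport y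
      · rw [hη1 x hx]
        have : |y x| ≤ c := hc x
        linarith [(abs_le.1 this).1]
      · rw [image_eq_zero_of_notMem_tsupport hx, add_zero]
        exact mul_nonneg hc0 (hη01 x).1)
  let Λ : C_c(Rn n, ℝ) →ₚ[ℝ] ℝ := PositiveLinearMap.mk₀ g fun f hf => hg0 f hf
  refine ⟨RealRMK.rieszMeasure Λ, inferInstance, fun f hf hfc => ?_⟩
  exact (RealRMK.integral_rieszMeasure Λ ⟨⟨f, hf.continuous⟩, hfc⟩).trans
    (hg ⟨⟨⟨f, hf.continuous⟩, hfc⟩, hf⟩)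

/-- For compact K ⊆ U, a test function lies between the indicators of K and U; inner regularity of μ
on open sets does the rest. -/
theorem measure_le_of_integral_isTestFunction_eq {μ ν : Measure (Rn n)} [IsFiniteMeasure μ]
    [IsFiniteMeasure ν] {U : Set (Rn n)} (hU : IsOpen U)
    (h : ∀ ψ, IsTestFunction U ψ → ∫ x, ψ x ∂μ = ∫ x, ψ x ∂ν) : μ U ≤ ν U := by
  rw [hU.measure_eq_iSup_isCompact]
  refine iSup₂_le fun K hKU => iSup_le fun hK => ?_
  obtain ⟨ψ, hψ, hψ01, hψ1⟩ := exists_isTestFunction_eq_one hK hU hKU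
  rw [← ENNReal.toReal_le_toReal (measure_ne_top _ _) (measure_ne_top _ _)]
  calc μ.real K = ∫ x, K.indicator 1 x ∂μ := (integral_indicator_one hK.measurableSet).symm
    _ ≤ ∫ x, ψ x ∂μ := by
        refine integral_mono ((integrable_indicator_iff hK.measurableSet).2
          (integrableOn_const (measure_ne_top _ _))) (hψ.integrable μ) fun x => ?_
        by_cases hx : x ∈ K
        · simp [hx, hψ1 x hx]
        · simp [hx, (hψ01 x).1]
    _ = ∫ x, ψ x ∂ν := h ψ hψ
    _ ≤ ∫ x, U.indicator 1 x ∂ν := by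
        refine integral_mono (hψ.integrable ν) ((integrable_indicator_iff hU.measurableSet).2
          (integrableOn_const (measure_ne_top _ _))) fun x => ?_
        by_cases hx : x ∈ U
        · simp [hx, (hψ01 x).2]
        · rw [image_eq_zero_of_notMem_tsupport fun h' => hx (hψ.support_subset h')]
          simp [hx]
    _ = ν.real U := integral_indicator_one hU.measurableSet

theorem restrict_eq_of_integral_isTestFunction_eq {μ ν : Measure (Rn n)} [IsFiniteMeasure μ]
    [IsFiniteMeasure ν] {U : Set (Rn n)} (hU : IsOpen U)
    (h : ∀ ψ, IsTestFunction U ψ → ∫ x, ψ x ∂μ = ∫ x, ψ x ∂ν) :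
    μ.restrict U = ν.restrict U := by
  have key : ∀ V, IsOpen V → μ.restrict U V = ν.restrict U V := fun V hV => by
    rw [Measure.restrict_apply hV.measurableSet, Measure.restrict_apply hV.measurableSet]
    exact le_antisymm
      (measure_le_of_integral_isTestFunction_eq (hV.inter hU)
        fun ψ hψ => h ψ (hψ.mono inter_subset_right))
      (measure_le_of_integral_isTestFunction_eq (hV.inter hU)
        fun ψ hψ => (h ψ (hψ.mono inter_subset_right)).symm)
  exact ext_of_generate_finite _ (BorelSpace.measurable_eq (α := Rn n)) isPiSystem_isOpen key
    (key _ isOpen_univ)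

/-- The fundamental lemma of the calculus of variations. It makes the flux independent of the
representative of the gradient. -/
theorem IsWeakGradient.ae_eq {U : Set (Rn n)} (hU : IsOpen U) {v : Rn n → ℝ}
    {G₁ G₂ : Rn n → Rn n} (h₁ : IsWeakGradient U v G₁) (h₂ : IsWeakGradient U v G₂) :
    ∀ᵐ x, x ∈ U → G₁ x = G₂ x := by
  have hint : ∀ {G : Rn n → Rn n}, IsWeakGradient U v G → ∀ g : Rn n → ℝ, IsTestFunction U g →
      Integrable (fun x => g x • G x) ∧ ∫ x, g x • G x = ∫ x in U, g x • G x := by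
    intro G hG g hg
    obtain ⟨c, hc⟩ := hg.smooth.continuous.bounded_above_of_compact_support hg.compact
    refine ⟨?_, ?_⟩
    · refine (integrableOn_iff_integrable_of_support_subset (s := tsupport g) fun x hx => ?_).1
        ((hG.2.1.integrableOn_compact_subset hg.support_subset hg.compact).bdd_smul (C := c)
          hg.smooth.continuous.aestronglyMeasurable (Eventually.of_forall hc))
      by_contra h'
      exact hx (by simp only [image_eq_zero_of_notMem_tsupport h', zero_smul])
    · rw [setIntegral_eq_integral_of_forall_compl_eq_zero fun x hx => by
        rw [image_eq_zero_of_notMem_tsupport fun h' => hx (hg.support_subset h'), zero_smul]]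
  have := hU.ae_eq_zero_of_integral_contDiff_smul_eq_zero (μ := volume) (h₁.2.1.sub h₂.2.1)
    fun g hg hgc hgs => by
      have hgt : IsTestFunction U g := ⟨hg, hgc, hgs⟩
      obtain ⟨i₁, e₁⟩ := hint h₁ g hgt
      obtain ⟨i₂, e₂⟩ := hint h₂ g hgt
      simp only [Pi.sub_apply, smul_sub]
      rw [integral_sub i₁ i₂, e₁, e₂, sub_eq_zero, ← neg_inj, ← h₁.2.2 g hgt, ← h₂.2.2 g hgt]
  filter_upwards [this] with x hx hxU
  exact sub_eq_zero.1 (hx hxU)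

end Representation

/-! ### From the subsolution to its measure -/

namespace IsVanishingPxHarmonic

variable {n : ℕ} {p : Rn n → ℝ} {U D : Set (Rn n)} {v : Rn n → ℝ} {G G' : Rn n → Rn n}

/-- Any weak gradient of v on U agrees almost everywhere there with the zero extension of G, and the
flux of a zero extension is the zero extension of the flux. -/
theorem integral_inner_flux_eq (h : IsVanishingPxHarmonic p U D v G)
    (hG' : MemVarSobolevLoc p U v G') {ψ : Rn n → ℝ} (hψ : IsTestFunction U ψ) :
    Integrable (fun x => inner ℝ (pxFlux p G' x) (gradient ψ x)) ∧
      ∫ x, inner ℝ (pxFlux p G' x) (gradient ψ x) =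
        ∫ x in D, inner ℝ (pxFlux p G x) (gradient ψ x) := by
  have hDm := h.isOpen_inner.measurableSet
  have hae : (fun x => inner ℝ (pxFlux p G' x) (gradient ψ x)) =ᵐ[volume]
      D.indicator fun x => inner ℝ (pxFlux p G x) (gradient ψ x) := by
    filter_upwards [hG'.1.ae_eq h.isOpen_outer h.memVarSobolevLoc.1] with x hx
    by_cases hxU : x ∈ U
    · have e : pxFlux p G' x = D.indicator (pxFlux p G) x := by
        rw [← pxFlux_indicator, pxFlux, pxFlux, hx hxU]
      by_cases hxD : x ∈ D <;> simp [e, hxD]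
    · rw [gradient_eq_zero_of_notMem_tsupport fun h' => hxU (hψ.support_subset h'),
        inner_zero_right, indicator_of_notMem fun h' => hxU (h.subset h')]
  refine ⟨((integrable_indicator_iff hDm).2 (h.integrableOn_inner_flux hψ)).congr hae.symm, ?_⟩
  rw [integral_congr_ae hae, integral_indicator hDm]

/-- The measure associated with a nonnegative vanishing solution, localised by a cutoff. -/
theorem exists_measure (h : IsVanishingPxHarmonic p U D v G) {χ : Rn n → ℝ}
    (hχ : IsTestFunction U χ) (hχ0 : ∀ x, 0 ≤ χ x) :
    ∃ μ : Measure (Rn n), IsFiniteMeasureOnCompacts μ ∧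
      ∀ f : Rn n → ℝ, ContDiff ℝ ∞ f → HasCompactSupport f → ∫ x, f x ∂μ =
        -∫ x in D, inner ℝ (pxFlux p G x) (gradient (fun y => χ y * f y) x) := by
  refine exists_measure_of_nonneg
    (fun φ => -∫ x in D, inner ℝ (pxFlux p G x) (gradient φ x)) (fun φ ψ hφ hψ => ?_)
    (fun c φ hφ => ?_) (fun φ hφ hφ0 => ?_) hχ hχ0
  · rw [← neg_add, ← integral_add (h.integrableOn_inner_flux hφ) (h.integrableOn_inner_flux hψ)]
    simp only [gradient_add (hφ.smooth.differentiable (by simp) _)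
      (hψ.smooth.differentiable (by simp) _), inner_add_right]
  · rw [mul_neg, ← integral_const_mul]
    simp only [gradient_const_mul (hφ.smooth.differentiable (by simp) _), real_inner_smul_right]
  · have := h.integral_inner_flux_nonpos hφ hφ0
    linarith

end IsVanishingPxHarmonic

/-! ### Zero extension, support of the measure and conclusion -/

theorem continuousOn_indicator_of_eq_zero_frontier {n : ℕ} {Ω U : Set (Rn n)} {u : Rn n → ℝ}
    (hu : ContinuousOn u (closure Ω ∩ U)) (h0 : ∀ x ∈ frontier Ω ∩ U, u x = 0) :
    ContinuousOn (Ω.indicator u) U := by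
  classical
  rw [← piecewise_eq_indicator]
  exact ContinuousOn.piecewise (fun x hx => h0 x hx.symm) (by rwa [inter_comm]) continuousOn_const

theorem IsPxHarmonic.exists_isVanishingPxHarmonic {n : ℕ} {p : Rn n → ℝ}
    (hp : IsBoundedLogHolderExponent p) {Ω U : Set (Rn n)} (hΩ : IsOpen Ω) (hU : IsOpen U)
    {u : Rn n → ℝ} (hu : IsPxHarmonic p (Ω ∩ U) u) (hpos : ∀ x ∈ Ω ∩ U, 0 < u x)
    (hcont : ContinuousOn u (closure Ω ∩ U)) (hzero : ∀ x ∈ frontier Ω ∩ U, u x = 0) :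
    ∃ G, IsVanishingPxHarmonic p U (Ω ∩ U) (Ω.indicator u) G := by
  obtain ⟨-, G, ⟨⟨hu1, hG1, hw⟩, hK⟩, hharm⟩ := hu
  have heq : EqOn (Ω.indicator u) u (Ω ∩ U) := fun x hx => indicator_of_mem hx.1 u
  have hc := continuousOn_indicator_of_eq_zero_frontier hcont hzero
  refine ⟨G, hp, hU, hΩ.inter hU, inter_subset_right, hc, fun x hx hxD => ?_, fun x hx => ?_,
    ⟨⟨?_, hG1, fun φ hφ => ?_⟩, fun K hKc hKD => ⟨?_, (hK K hKc hKD).2⟩⟩, hharm⟩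
  · exact indicator_of_notMem (fun h => hxD ⟨h, hx⟩) _
  · rw [heq hx]
    exact hpos x hx
  · exact (hc.mono inter_subset_right).locallyIntegrableOn (hΩ.inter hU).measurableSet
  · rw [← hw φ hφ]
    exact setIntegral_congr_fun (hΩ.inter hU).measurableSet fun x hx => by simp only [heq hx]
  · have h1 := (memVarLp_iff hp).1 (hK K hKc hKD).1
    have h2 : ∀ᵐ x ∂volume.restrict K, u x = Ω.indicator u x := by
      filter_upwards [ae_restrict_mem hKc.measurableSet] with x hx
      exact (heq (hKD hx)).symm
    refine (memVarLp_iff hp).2 ⟨h1.1.congr h2, h1.2.congr ?_⟩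
    filter_upwards [h2] with x hx
    rw [hx]

/-- Test functions supported in Ω ∩ B integrate to zero by the equation. Those supported off the
closure of Ω do so because their gradient vanishes on Ω. Comparison with the zero measure then kills
both open sets. -/
theorem measure_compl_eq_zero_of_integral {n : ℕ} {p : Rn n → ℝ} {Ω U B : Set (Rn n)}
    {v : Rn n → ℝ} {G : Rn n → Rn n} (hΩ : IsOpen Ω)
    (h : IsVanishingPxHarmonic p U (Ω ∩ U) v G) (hB : IsOpen B) (hBU : B ⊆ U)
    {μ : Measure (Rn n)} [IsFiniteMeasure μ] (hμB : μ Bᶜ = 0)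
    (hμ : ∀ ψ, IsTestFunction B ψ →
      ∫ x in Ω ∩ U, inner ℝ (pxFlux p G x) (gradient ψ x) = -∫ x, ψ x ∂μ) :
    μ (frontier Ω ∩ B)ᶜ = 0 := by
  have h1 : μ (Ω ∩ B) = 0 := by
    refine le_antisymm ?_ zero_le
    refine (measure_le_of_integral_isTestFunction_eq (ν := 0) (hΩ.inter hB) fun ψ hψ => ?_).trans
      (by simp)
    have h2 := hμ ψ (hψ.mono inter_subset_right)
    rw [h.harmonic ψ (hψ.mono (inter_subset_inter_right _ hBU))] at h2
    rw [integral_zero_measure]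
    linarith
  have h3 : μ ((closure Ω)ᶜ ∩ B) = 0 := by
    refine le_antisymm ?_ zero_le
    refine (measure_le_of_integral_isTestFunction_eq (ν := 0)
      (isClosed_closure.isOpen_compl.inter hB) fun ψ hψ => ?_).trans (by simp)
    have h2 := hμ ψ (hψ.mono inter_subset_right)
    rw [setIntegral_eq_zero_of_forall_eq_zero fun x hx => by
      rw [gradient_eq_zero_of_notMem_tsupport fun h' =>
        (hψ.support_subset h').1 (subset_closure hx.1), inner_zero_right]] at h2
    rw [integral_zero_measure]
    linarith
  refine measure_mono_null (t := Bᶜ ∪ (Ω ∩ B ∪ (closure Ω)ᶜ ∩ B)) (fun x hx => ?_)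
    (measure_union_null hμB (measure_union_null h1 h3))
  rw [hΩ.frontier_eq] at hx
  by_cases hxB : x ∈ B
  · by_cases hxΩ : x ∈ Ω
    · exact Or.inr (Or.inl ⟨hxΩ, hxB⟩)
    · exact Or.inr (Or.inr ⟨fun hc => hx ⟨⟨hc, hxΩ⟩, hxB⟩, hxB⟩)
  · exact Or.inl hxB

theorem lemma6p2 (n : ℕ) (hn : 2 ≤ n)
    (p : EuclideanSpace ℝ (Fin n) → ℝ) (hp : IsBoundedLogHolderExponent p)
    (Ω : Set (EuclideanSpace ℝ (Fin n))) (hΩ : IsOpen Ω)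
    (w : EuclideanSpace ℝ (Fin n)) (hw : w ∈ frontier Ω) (r : ℝ) (hr : 0 < r)
    (u : EuclideanSpace ℝ (Fin n) → ℝ)
    (hu_harm : IsPxHarmonic p (Ω ∩ Metric.ball w (2 * r)) u)
    (hu_pos : ∀ x ∈ Ω ∩ Metric.ball w (2 * r), 0 < u x)
    (hu_cont : ContinuousOn u (closure Ω ∩ Metric.ball w (2 * r)))
    (hu_zero : ∀ x ∈ frontier Ω ∩ Metric.ball w (2 * r), u x = 0) :
    -- the extension of `u` by zero has a gradient in `B(w, 2r)`
    (∃ G : EuclideanSpace ℝ (Fin n) → EuclideanSpace ℝ (Fin n),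
      MemVarSobolevLoc p (Metric.ball w (2 * r)) (Ω.indicator u) G) ∧
    ∃! μ : Measure (EuclideanSpace ℝ (Fin n)),
      IsFiniteMeasure μ ∧ μ ((frontier Ω ∩ Metric.ball w r)ᶜ) = 0 ∧
      ∀ G : EuclideanSpace ℝ (Fin n) → EuclideanSpace ℝ (Fin n),
        MemVarSobolevLoc p (Metric.ball w (2 * r)) (Ω.indicator u) G →
        ∀ ψ : EuclideanSpace ℝ (Fin n) → ℝ, IsTestFunction (Metric.ball w r) ψ →
          Integrable (fun x => inner ℝ (pxFlux p G x) (gradient ψ x)) volume ∧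
          ∫ x, inner ℝ (pxFlux p G x) (gradient ψ x) = - ∫ x, ψ x ∂μ := by
  obtain ⟨G, h⟩ := hu_harm.exists_isVanishingPxHarmonic hp hΩ isOpen_ball hu_pos hu_cont hu_zero
  have hBU : ball w r ⊆ ball w (2 * r) := ball_subset_ball (by linarith)
  -- Multiplying by χ makes the functional meaningful on all of C₀^∞(ℝⁿ) and changes nothing for ψ
  -- supported in B(w, r). Where χ is not 1 the measure μ₀ has no meaning for u, so it is restricted
  -- to the ball below.
  obtain ⟨χ, hχ, hχ01, hχ1⟩ := exists_isTestFunction_eq_one (isCompact_closedBall w r)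
    (isOpen_ball (x := w) (ε := 2 * r)) (closedBall_subset_ball (by linarith))
  obtain ⟨μ₀, hμ₀, hμ₀T⟩ := h.exists_measure hχ fun x => (hχ01 x).1
  have hfin : IsFiniteMeasure (μ₀.restrict (ball w r)) :=
    ⟨by rw [Measure.restrict_apply_univ]; exact measure_ball_lt_top⟩
  have hrep : ∀ ψ, IsTestFunction (ball w r) ψ →
      ∫ x in Ω ∩ ball w (2 * r), inner ℝ (pxFlux p G x) (gradient ψ x) =
        -∫ x, ψ x ∂μ₀.restrict (ball w r) := by
    intro ψ hψ
    have hz : ∀ x ∉ ball w r, ψ x = 0 := fun x hx =>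
      image_eq_zero_of_notMem_tsupport fun h' => hx (hψ.support_subset h')
    have hχψ : (fun y => χ y * ψ y) = ψ := by
      ext y
      by_cases hy : y ∈ ball w r
      · rw [hχ1 y (ball_subset_closedBall hy), one_mul]
      · rw [hz y hy, mul_zero]
    rw [setIntegral_eq_integral_of_forall_compl_eq_zero hz, hμ₀T ψ hψ.smooth hψ.compact, hχψ,
      neg_neg]
  refine ⟨⟨_, h.memVarSobolevLoc⟩, μ₀.restrict (ball w r), ⟨hfin, ?_, fun G' hG' ψ hψ => ?_⟩, ?_⟩
  · refine measure_compl_eq_zero_of_integral hΩ h isOpen_ball hBU ?_ hrep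
    rw [Measure.restrict_apply measurableSet_ball.compl, compl_inter_self, measure_empty]
  · obtain ⟨h1, h2⟩ := h.integral_inner_flux_eq hG' (hψ.mono hBU)
    exact ⟨h1, h2.trans (hrep ψ hψ)⟩
  -- The representation assumed of ν is quantified over gradients, so it has content only because a
  -- gradient exists; it is applied to the zero extension of G.
  · rintro ν ⟨hν, hν0, hνrep⟩
    have hνB : ν.restrict (ball w r) = ν := by
      refine Measure.restrict_eq_self_of_ae_mem ?_
      rw [ae_iff]
      exact measure_mono_null (compl_subset_compl.2 inter_subset_right) hν0
    have := restrict_eq_of_integral_isTestFunction_eq (μ := ν) (ν := μ₀.restrict (ball w r))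
      isOpen_ball fun ψ hψ => by
        have e1 := (hνrep _ h.memVarSobolevLoc ψ hψ).2
        rw [(h.integral_inner_flux_eq h.memVarSobolevLoc (hψ.mono hBU)).2, hrep ψ hψ] at e1
        linarith
    rwa [hνB, Measure.restrict_restrict measurableSet_ball, inter_self] at this
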